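/- **Setting.** Let $q$ be a prime power, $m\ge 0$, $s\ge 1$, $d\ge 0$ integers. For a multi-index $\mathbf i\in\mathbb Z_{\ge0}^m$ put $\mathrm{wt}(\mathbf i)=\sum_k i_k$, and let $P^{(\mathbf i)}$ be the $\mathbf i$-th Hasse derivative of $P\in\mathbb F_q[X_1,\dots,X_m]$, i.e. the coefficient of $\mathbf Z^{\mathbf i}$ in $P(\mathbf X+\mathbf Z)$. Let $\Sigma=\mathbb F_q^{\{\mathbf i:\mathrm{wt}(\mathbf i)<s\}}$, $P^{(<s)}(\mathbf a)=(P^{(\mathbf i)}(\mathbf a))_{\mathrm{wt}(\mathbf i)<s}\in\Sigma$ and $\mathrm{Enc}_{s,d,m,q}(P)=(P^{(<s)}(\mathbf a))_{\mathbf a\in\mathbb F_q^m}$ for $\deg P\le d$. Let $\Delta$ be the normalized Hamming distance, $\delta=1-\frac{d}{sq}$, $\delta_0<\delta/8$, $\gamma=\frac{\delta-8\delta_0}{1-8\delta_0}$, $c=\lfloor\gamma s\rfloor+1$, and let $S\subseteq\mathbb F_q$ be any set with $|S|=\lceil 5s/c\rceil$. **Algorithm.** Input: oracle access to $r:\mathbb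 F_q^m\to\Sigma$ (with coordinates $r^{(\mathbf i)}$), and a point $\mathbf a\in\mathbb F_q^m$. 1. Pick $\mathbf z,\mathbf y_1,\dots,\mathbf y_m\in\mathbb F_q^m$ independently and uniformly at random, and let $B=\{\mathbf z+\sum_j\alpha_j\mathbf y_j:\alpha\in S^m\}$. Query $r$ at all points $\mathbf a+t\mathbf b$ with $\mathbf b\in B$, $t\in\mathbb F_q$. 2. For each $\mathbf b\in B$ and each $\mathbf l$ with $\mathrm{wt}(\mathbf l)<c$ define $\ell_{\mathbf b,\mathbf l}:\mathbb F_q\to\mathbb F_q^{\,s-\mathrm{wt}(\mathbf l)}$ by $$(\ell_{\mathbf b,\mathbf l}(t))_j=\sum_{\mathrm{wt}(\mathbf i)=j}\binom{\mathbf l+\mathbf i}{\mathbf l}\,r^{(\mathbf l+\mathbf i)}(\mathbf a+t\mathbf b)\,\mathbf b^{\mathbf i}\qquad(0\le j<s-\mathrm{wt}(\mathbf l)),$$ and let $Q_{\mathbf b,\mathbf l}(T)$ be the unique polynomial of degree at most $d-\mathrm{wt}(\mathbf l)$, if any, with $\Delta(\mathrm{Enc}_{s-\mathrm{wt}(\mathbf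 l),\,d-\mathrm{wt}(\mathbf l),\,1,\,q}(Q_{\mathbf b,\mathbf l}),\ell_{\mathbf b,\mathbf l})<4\delta_0$ (univariate multiplicity decoding). Let $v_{j,\mathbf b,\mathbf l}$ be the coefficient of $T^j$ in $Q_{\mathbf b,\mathbf l}$, and $v_{j,\mathbf b,\mathbf l}=0$ for $j<0$. 3. For each $0\le j'<s$ find the unique homogeneous polynomial $R_{j'}$ of degree $j'$ such that for at least $2/3$ of the $\mathbf b\in B$ one has $R_{j'}^{(\mathbf l)}(\mathbf b)=v_{j'-\mathrm{wt}(\mathbf l),\mathbf b,\mathbf l}$ for all $\mathbf l$ with $\mathrm{wt}(\mathbf l)<c$ (multivariate multiplicity decoding; the equation counts as violated when its right-hand side is undefined). If for some $j'$ there is no such $R_{j'}$ or more than one, output FAIL. Otherwise output $(u_{\mathbf i})_{\mathrm{wt}(\mathbf i)<s}$, where $u_{\mathbf i}$ is the coefficient of $\mathbf X^{\mathbf i}$ in $R_{\mathrm{wt}(\mathbf i)}$. **Theorem.** Let $P\in\mathbb F_q[X_1,\dots,X_m]$ with $\deg P\le d$ and $r:\mathbb F_q^m\to\Sigma$ satisfy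 $\Delta(\mathrm{Enc}_{s,d,m,q}(P),r)<\delta_0$. Then for every $\mathbf a\in\mathbb F_q^m$ the algorithm outputs $P^{(<s)}(\mathbf a)$ with high probability, namely with probability at least $$1-\frac{27}{|S|^m+27}-\frac{4}{\delta_0\,q}.$$ For every choice of $\mathbf z,\mathbf y_1,\dots,\mathbf y_m$ its queries are exactly the points of the lines $\{\mathbf a+t\mathbf b:t\in\mathbb F_q\}$, $\mathbf b\in B$; there are at most $|S|^m$ directions $\mathbf b\in B$ and at most $|S|^m q$ queries, where $|S|\le\lceil 5/\gamma\rceil$. -/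

import Mathlib

namespace MultCode

noncomputable section

open scoped Classical

/-! ### Codes -/

/-- The normalized Hamming distance `Δ(x, y)`: the fraction of coordinates in which `x`, `y` differ. -/
def relDist {ι A : Type*} [Fintype ι] (x y : ι → A) : ℝ :=
  (hammingDist x y : ℝ) / (Fintype.card ι : ℝ)

/-- The probability of an event under the uniform distribution on a finite set. -/
def uniformProb {Ω : Type*} [Fintype Ω] (p : Ω → Prop) : ℝ :=
  ((Finset.univ.filter p).card : ℝ) / (Fintype.card Ω : ℝ)

/-! ### Hasse derivatives and multiplicity codes

Multi-indices are elements `i : Fin m →₀ ℕ`, with weight `i.degree = ∑ k, i k`. -/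

/-- The `i`-th Hasse derivative of `P`: the coefficient of `Z ^ i` in `P(X + Z)`, where `P(X + Z)`
is regarded as a polynomial in `Z` whose coefficients are polynomials in `X`. -/
def hasse {σ R : Type*} [CommSemiring R] (i : σ →₀ ℕ) (P : MvPolynomial σ R) : MvPolynomial σ R :=
  MvPolynomial.coeff i
    (MvPolynomial.aeval
      (fun k : σ => (MvPolynomial.C (MvPolynomial.X k) + MvPolynomial.X k :
        MvPolynomial σ (MvPolynomial σ R))) P)

/-- The alphabet `Σ` of the order-`s` code in `m` variables: one field element for each multi-index
of weight less than `s`. -/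
abbrev Alphabet (F : Type*) (m s : ℕ) : Type _ :=
  {i : Fin m →₀ ℕ // i.degree < s} → F

variable {F : Type*} [Field F] {m : ℕ}

/-- The order-`s` evaluation `P^{(<s)}(a)`. -/
def orderEval (s : ℕ) (P : MvPolynomial (Fin m) F) (a : Fin m → F) : Alphabet F m s :=
  fun i => MvPolynomial.eval a (hasse i.1 P)

/-- The codeword of `P` in the `m`-variate multiplicity code of order `s`. -/
def enc (s : ℕ) (P : MvPolynomial (Fin m) F) : (Fin m → F) → Alphabet F m s :=
  fun a => orderEval s P a

/-- The codeword of `Q` in the univariate multiplicity code of order `n`. -/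
def uniEnc (n : ℕ) (Q : Polynomial F) : F → (Fin n → F) :=
  fun t j => (Polynomial.hasseDeriv (j : ℕ) Q).eval t

/-! ### Parameters of the algorithm -/

/-- The (designed) distance `δ = 1 - d / (s q)`. -/
def delta (s d q : ℕ) : ℝ := 1 - (d : ℝ) / ((s : ℝ) * (q : ℝ))

/-- `γ = (δ - 8 δ₀) / (1 - 8 δ₀)`. -/
def gam (s d q : ℕ) (δ₀ : ℝ) : ℝ := (delta s d q - 8 * δ₀) / (1 - 8 * δ₀)

/-- `c = γ s + 1`, with `γ s` rounded down to an integer. -/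
def ordC (s d q : ℕ) (δ₀ : ℝ) : ℕ := ⌊gam s d q δ₀ * (s : ℝ)⌋₊ + 1

/-- The size `⌈5 s / c⌉` of the set `S`. -/
def gridSize (s d q : ℕ) (δ₀ : ℝ) : ℕ := ⌈5 * (s : ℝ) / (ordC s d q δ₀ : ℝ)⌉₊

/-! ### Non-adaptive oracle algorithms -/

/-- A non-adaptive algorithm with oracle access to a word `r : I → A`: it fixes a finite set of
queries, and its output is a function of the answers to these queries alone. -/
structure QueryAlg (I A O : Type*) where
  /-- The positions at which the word is queried. -/
  queries : Finset I
  /-- The output, as a function of the answers. -/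
  output : ({x // x ∈ queries} → A) → O

/-- The output of the algorithm on the word `r`. -/
def QueryAlg.run {I A O : Type*} (M : QueryAlg I A O) (r : I → A) : O :=
  M.output (fun x => r x.1)

/-! ### The local correction algorithm -/

/-- The unique `x` such that `p x`; `none` if there is no such `x` or more than one. -/
def findUnique {α : Type*} (p : α → Prop) : Option α :=
  if h : ∃! x, p x then some h.choose else none

/-- The set of directions `B = {z + ∑ j, α j • y j | α ∈ S ^ m}`. -/
def directions (S : Finset F) (z : Fin m → F) (y : Fin m → Fin m → F) : Finset (Fin m → F) :=
  (Fintype.piFinset (fun _ : Fin m => S)).image (fun α => z + ∑ j, α j • y j)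

/-- The points of the lines `{a + t • b | t ∈ F}`, for all directions `b ∈ B`. -/
def linePoints [Fintype F] (a : Fin m → F) (B : Finset (Fin m → F)) : Finset (Fin m → F) :=
  (B ×ˢ (Finset.univ : Finset F)).image (fun p => a + p.2 • p.1)

/-- The coordinate with multi-index `i` of a symbol (only used for `i.degree < s`). -/
def symbolCoord {s : ℕ} (u : Alphabet F m s) (i : Fin m →₀ ℕ) : F :=
  if h : i.degree < s then u ⟨i, h⟩ else 0

/-- The binomial coefficient `(l + i choose l) = ∏ k, (l k + i k choose l k)`. -/
def multiChoose (l i : Fin m →₀ ℕ) : ℕ := ∏ k, (l k + i k).choose (l k)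

/-- The univariate received word `ℓ_{b,l}` on the line through `a` in direction `b`: its `j`-th
coordinate at `t` is the sum of `(l + i choose l) * r^{(l + i)}(a + t b) * b ^ i` over all `i` of
weight `j`, for `j < s - wt(l)`. -/
def lineWord {s : ℕ} (r : (Fin m → F) → Alphabet F m s) (a b : Fin m → F) (l : Fin m →₀ ℕ) :
    F → (Fin (s - l.degree) → F) :=
  fun t j => ∑ i ∈ Finset.finsuppAntidiag (Finset.univ : Finset (Fin m)) (j : ℕ),
    (multiChoose l i : F) * symbolCoord (r (a + t • b)) (l + i) * ∏ k, b k ^ i k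

/-- Univariate decoding: the unique polynomial `Q_{b,l}` of degree at most `d - wt(l)` (only `0` if
this is negative) whose codeword of order `s - wt(l)` is at distance less than `4 δ₀` from
`ℓ_{b,l}`, if there is one. -/
def decodeLine [Fintype F] {s : ℕ} (d : ℕ) (δ₀ : ℝ) (r : (Fin m → F) → Alphabet F m s)
    (a b : Fin m → F) (l : Fin m →₀ ℕ) : Option (Polynomial F) :=
  findUnique (fun Q => Q ∈ Polynomial.degreeLT F (d + 1 - l.degree) ∧
    relDist (uniEnc (s - l.degree) Q) (lineWord r a b l) < 4 * δ₀)

/-- The value `v_{j' - wt(l), b, l}`: the coefficient of `T ^ (j' - wt(l))` in `Q_{b,l}`, which is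
`0` if `j' < wt(l)`, and otherwise undefined (`none`) if `Q_{b,l}` does not exist. -/
def lineValue [Fintype F] {s : ℕ} (d : ℕ) (δ₀ : ℝ) (r : (Fin m → F) → Alphabet F m s)
    (a : Fin m → F) (j' : ℕ) (b : Fin m → F) (l : Fin m →₀ ℕ) : Option F :=
  if l.degree ≤ j' then (decodeLine d δ₀ r a b l).map (fun Q => Q.coeff (j' - l.degree))
  else some 0

/-- `R` is homogeneous of degree `j'`, and for at least `2/3` of the directions `b ∈ B` one has
`R^{(l)}(b) = v_{j' - wt(l), b, l}` for all `l` with `wt(l) < c`. -/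
def IsCombination [Fintype F] {s : ℕ} (d : ℕ) (δ₀ : ℝ) (r : (Fin m → F) → Alphabet F m s)
    (a : Fin m → F) (B : Finset (Fin m → F)) (j' : ℕ) (R : MvPolynomial (Fin m) F) : Prop :=
  R.IsHomogeneous j' ∧
    2 * B.card ≤ 3 * (B.filter (fun b => ∀ l : Fin m →₀ ℕ,
      l.degree < ordC s d (Fintype.card F) δ₀ →
        lineValue d δ₀ r a j' b l = some (MvPolynomial.eval b (hasse l R)))).card

/-- The combination step: for each `j' < s` find the unique `R_{j'}`, and output the coefficients of
`X ^ i` in `R_{wt(i)}`, for all `i` with `wt(i) < s`. The result is `none` (the algorithm fails) if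
some `R_{j'}` does not exist or is not unique. -/
def combine [Fintype F] {s : ℕ} (d : ℕ) (δ₀ : ℝ) (r : (Fin m → F) → Alphabet F m s)
    (a : Fin m → F) (B : Finset (Fin m → F)) : Option (Alphabet F m s) :=
  if h : ∀ j' : Fin s, ∃! R : MvPolynomial (Fin m) F, IsCombination d δ₀ r a B (j' : ℕ) R then
    some (fun i => MvPolynomial.coeff i.1 (h ⟨i.1.degree, i.2⟩).choose)
  else none

/-- The local correction algorithm at the point `a`, with grid `S ^ m` and random choices `z`, `y`.
It queries the received word on the lines through `a` with directions in `B`, decodes on these lines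
and combines the results. (The word is extended by `0` to the points that are not queried.) -/
def localCorrector [Fintype F] (s d : ℕ) (δ₀ : ℝ) (S : Finset F) (a : Fin m → F)
    (z : Fin m → F) (y : Fin m → Fin m → F) :
    QueryAlg (Fin m → F) (Alphabet F m s) (Option (Alphabet F m s)) where
  queries := linePoints a (directions S z y)
  output := fun ans =>
    combine d δ₀
      (fun x => if h : x ∈ linePoints a (directions S z y) then ans ⟨x, h⟩ else 0)
      a (directions S z y)

end

end MultCode

/-!
Write `P(a + X) = ∑ j, R_j(X)` with `R_j` homogeneous of degree `j`. The coefficients of the `R_j`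
with `j < s` are the coordinates of `P^{(<s)}(a)`, and the coefficient of `T ^ j` in the restriction
of `P^{(l)}` to the line `a + T b` is `R_{j + wt(l)}^{(l)}(b)`. If `r` differs from the codeword of
`P` on less than a `4 δ₀` fraction of that line, then, for every `l` with `wt(l) < c`, univariate
decoding recovers this restriction, so that all the equations for `R_{j'}` at `b` hold. If this
happens for at least two thirds of the directions in `B`, then `R_{j'}` is a candidate in the
combination step. Any two candidates agree to order `c` on at least a third of `B`; as their
degree is less than `s` and `|S| c ≥ 5 s`, they are equal by the Schwartz–Zippel lemma with
multiplicities, provided that the `y_j` are linearly independent, so that `B` is an injective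
affine image of the grid `S ^ m`.

A single direction is uniformly distributed, hence bad with probability at most
`1 / 4 + 1 / (4 δ₀ q)` by Markov's inequality, where `1 / (4 δ₀ q)` accounts for the point `a` that
all the lines share. The directions are pairwise independent, so Cantelli's inequality bounds the
probability that a third of them is bad. This deviates from `27 / (|S| ^ m + 27)`, the bound for bad
directions of probability exactly `1 / 4`, by at most `77 / 5` times `1 / (4 δ₀ q)`; linear
dependence of the `y_j` costs at most another `3 / 5` times that quantity.
-/

namespace MultCode

open MvPolynomial

section Hasse

variable {σ R : Type*} [CommSemiring R]

/-- The translate `P(a + X)` of `P`; its coefficients are the Hasse derivatives of `P` at `a`. -/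
noncomputable def translate (a : σ → R) : MvPolynomial σ R →ₐ[R] MvPolynomial σ R :=
  aeval (fun k => C (a k) + X k)

lemma coeff_translate (a : σ → R) (i : σ →₀ ℕ) (P : MvPolynomial σ R) :
    coeff i (translate a P) = eval a (hasse i P) := by
  rw [hasse, ← coeff_map]
  congr 1
  have h : translate a = (mapAlgHom (aeval a : MvPolynomial σ R →ₐ[R] R)).comp
      (aeval (fun k : σ => (C (X k) + X k : MvPolynomial σ (MvPolynomial σ R)))) := by
    ext k
    simp [translate]
  exact DFunLike.congr_fun h P

lemma translate_translate (a b : σ → R) (P : MvPolynomial σ R) :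
    translate a (translate b P) = translate (a + b) P := by
  have h : (translate a).comp (translate b) = translate (a + b) := by
    ext1 k
    simp only [translate, AlgHom.comp_apply, aeval_X, map_add, algHom_C, algebraMap_eq,
      Pi.add_apply]
    ring
  exact DFunLike.congr_fun h P

lemma totalDegree_aeval_le {τ : Type*} {g : σ → MvPolynomial τ R} (hg : ∀ k, (g k).totalDegree ≤ 1)
    (P : MvPolynomial σ R) : (aeval g P).totalDegree ≤ P.totalDegree := by
  rw [aeval_def, eval₂, Finsupp.sum]
  refine totalDegree_finsetSum_le fun e he => ?_
  calc _ ≤ 0 + ∑ k ∈ e.support, (g k ^ e k).totalDegree :=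
        (totalDegree_mul _ _).trans
          (add_le_add (totalDegree_C _).le (totalDegree_finsetProd _ _))
    _ ≤ ∑ k ∈ e.support, e k * 1 := by
        rw [zero_add]
        gcongr with k
        exact (totalDegree_pow _ _).trans (Nat.mul_le_mul_left _ (hg k))
    _ ≤ P.totalDegree := by simpa [Finsupp.sum] using le_totalDegree he

lemma totalDegree_translate_le (a : σ → R) (P : MvPolynomial σ R) :
    (translate a P).totalDegree ≤ P.totalDegree :=
  totalDegree_aeval_le
    (fun k => (totalDegree_add _ _).trans (by simp [(isHomogeneous_X R k).totalDegree_le])) P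

lemma translate_zero (P : MvPolynomial σ R) : translate 0 P = P := by
  simp [translate]

lemma hasse_add (i : σ →₀ ℕ) (P Q : MvPolynomial σ R) :
    hasse i (P + Q) = hasse i P + hasse i Q := by
  simp [hasse]

lemma monomial_eq_C_mul_prod [Fintype σ] (e : σ →₀ ℕ) (x : R) :
    monomial e x = C x * ∏ j, (X j : MvPolynomial σ R) ^ e j := by
  rw [monomial_eq, Finsupp.prod_fintype _ _ (by simp)]

lemma aeval_C_X_add_X_monomial [Fintype σ] [DecidableEq σ] (k : σ →₀ ℕ) (x : R) :
    aeval (fun j : σ => (C (X j) + X j : MvPolynomial σ (MvPolynomial σ R))) (monomial k x) =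
      ∑ f ∈ Fintype.piFinset (fun j => Finset.range (k j + 1)),
        monomial (Finsupp.equivFunOnFinite.symm f)
          (monomial (k - Finsupp.equivFunOnFinite.symm f) (x * ∏ j, ((k j).choose (f j) : R))) := by
  rw [aeval_monomial, Finsupp.prod_fintype _ _ (by simp)]
  simp_rw [add_comm (C (X _)), add_pow]
  rw [Finset.prod_univ_sum, Finset.mul_sum]
  refine Finset.sum_congr rfl fun f _ => ?_
  rw [monomial_eq_C_mul_prod, monomial_eq_C_mul_prod]
  simp only [Finset.prod_mul_distrib, map_mul, map_prod, map_pow, map_natCast,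
    Finsupp.coe_equivFunOnFinite_symm, Finsupp.coe_tsub, Pi.sub_apply, algebraMap_eq,
    MvPolynomial.algebraMap_apply]
  ring

lemma hasse_monomial [Fintype σ] (l k : σ →₀ ℕ) (x : R) :
    hasse l (monomial k x) = monomial (k - l) (x * ∏ j, ((k j).choose (l j) : R)) := by
  classical
  rw [hasse, aeval_C_X_add_X_monomial, coeff_sum, Finset.sum_eq_single (⇑l)]
  · simp
  · intro f _ hf
    rw [coeff_monomial, if_neg (by rintro rfl; simp at hf)]
  · intro hl
    obtain ⟨j, hj⟩ : ∃ j, k j < l j := by simpa [Nat.lt_succ_iff] using hl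
    rw [Finset.prod_eq_zero (Finset.mem_univ j) (by simp [Nat.choose_eq_zero_of_lt hj])]
    simp

variable {m : ℕ}

lemma coeff_hasse (l n : Fin m →₀ ℕ) (P : MvPolynomial (Fin m) R) :
    coeff n (hasse l P) = (multiChoose l n : R) * coeff (l + n) P := by
  induction P using MvPolynomial.induction_on' with
  | add p q hp hq => rw [hasse_add, coeff_add, coeff_add, hp, hq, mul_add]
  | monomial k x =>
    rw [hasse_monomial, coeff_monomial, coeff_monomial]
    by_cases hk : k = l + n
    · subst hk
      simp [multiChoose, mul_comm]
    · rw [if_neg hk, mul_zero, ite_eq_right_iff]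
      rintro rfl
      obtain ⟨j, hj⟩ : ∃ j, k j < l j := by
        by_contra! h
        exact hk (add_tsub_cancel_of_le (show l ≤ k from h)).symm
      rw [Finset.prod_eq_zero (Finset.mem_univ j) (by simp [Nat.choose_eq_zero_of_lt hj]), mul_zero]

lemma hasse_eq_zero_of_totalDegree_lt {l : Fin m →₀ ℕ} {P : MvPolynomial (Fin m) R}
    (h : P.totalDegree < l.degree) : hasse l P = 0 := by
  ext n
  rw [coeff_hasse, coeff_eq_zero_of_totalDegree_lt, mul_zero, coeff_zero]
  exact h.trans_le ((Nat.le_add_right _ _).trans_eq (map_add Finsupp.degree l n).symm)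

lemma multiChoose_mul_multiChoose (l i n : Fin m →₀ ℕ) :
    multiChoose i n * multiChoose l (i + n) = multiChoose l i * multiChoose (l + i) n := by
  simp only [multiChoose, ← Finset.prod_mul_distrib, Finsupp.add_apply]
  refine Finset.prod_congr rfl fun k _ => ?_
  have h := Nat.choose_mul (n := l k + i k + n k) (k := l k + i k) (s := l k) (by omega)
  rw [add_assoc, Nat.add_sub_cancel_left, Nat.add_sub_cancel_left] at h
  rw [add_assoc, mul_comm, ← h, mul_comm]

lemma hasse_hasse (l i : Fin m →₀ ℕ) (P : MvPolynomial (Fin m) R) :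
    hasse i (hasse l P) = C (multiChoose l i : R) * hasse (l + i) P := by
  ext n
  rw [coeff_C_mul, coeff_hasse, coeff_hasse, coeff_hasse, ← mul_assoc, ← mul_assoc, add_assoc]
  exact_mod_cast congrArg (fun k : ℕ => (k : R) * _) (multiChoose_mul_multiChoose l i n)

lemma hasse_translate (a : Fin m → R) (l : Fin m →₀ ℕ) (P : MvPolynomial (Fin m) R) :
    hasse l (translate a P) = translate a (hasse l P) := by
  ext n
  rw [coeff_hasse, coeff_translate, coeff_translate, hasse_hasse, map_mul, eval_C]

lemma hasse_homogeneousComponent (l : Fin m →₀ ℕ) (j : ℕ) (P : MvPolynomial (Fin m) R) :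
    hasse l (homogeneousComponent (l.degree + j) P) = homogeneousComponent j (hasse l P) := by
  ext n
  simp [coeff_hasse, coeff_homogeneousComponent]

end Hasse

section Line

variable {σ R : Type*} [CommSemiring R]

/-- The restriction `P(a + T b)` of `P` to the line through `a` in direction `b`. -/
noncomputable def restrictLine (a b : σ → R) : MvPolynomial σ R →ₐ[R] Polynomial R :=
  aeval (fun k => Polynomial.C (a k) + Polynomial.C (b k) * Polynomial.X)

lemma coeff_restrictLine_zero (b : σ → R) (P : MvPolynomial σ R) (j : ℕ) :
    (restrictLine 0 b P).coeff j = eval b (homogeneousComponent j P) := by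
  induction P using MvPolynomial.induction_on' with
  | add p q hp hq => simp only [map_add, Polynomial.coeff_add, hp, hq]
  | monomial e x =>
    have he : restrictLine 0 b (monomial e x) =
        Polynomial.C (eval b (monomial e x)) * Polynomial.X ^ e.degree := by
      simp [restrictLine, aeval_monomial, eval_monomial, mul_pow, Finsupp.prod, mul_assoc,
        Finset.prod_mul_distrib, Finset.prod_pow_eq_pow_sum, Finsupp.degree_apply]
    rw [he, Polynomial.coeff_C_mul_X_pow,
      homogeneousComponent_of_mem (isHomogeneous_monomial x rfl)]
    split_ifs <;> simp

lemma taylor_restrictLine (a b : σ → R) (t : R) (P : MvPolynomial σ R) :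
    Polynomial.taylor t (restrictLine a b P) = restrictLine 0 b (translate (a + t • b) P) := by
  have h : (Polynomial.taylorAlgHom t).comp (restrictLine a b) =
      (restrictLine 0 b).comp (translate (a + t • b)) := by
    ext1 k
    simp only [restrictLine, AlgHom.coe_comp, Function.comp_apply, aeval_X,
      Polynomial.taylorAlgHom_apply, Polynomial.taylor_apply, Polynomial.C_comp, Polynomial.X_comp,
      Pi.zero_apply, map_zero, zero_add, translate, Pi.add_apply, Pi.smul_apply, smul_eq_mul,
      map_add, algHom_C, Polynomial.algebraMap_eq, map_mul]
    ring
  exact DFunLike.congr_fun h P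

lemma eval_hasseDeriv_restrictLine (a b : σ → R) (t : R) (P : MvPolynomial σ R) (j : ℕ) :
    (Polynomial.hasseDeriv j (restrictLine a b P)).eval t =
      eval b (homogeneousComponent j (translate (a + t • b) P)) := by
  rw [← Polynomial.taylor_coeff, taylor_restrictLine, coeff_restrictLine_zero]

lemma coeff_restrictLine (a b : σ → R) (P : MvPolynomial σ R) (j : ℕ) :
    (restrictLine a b P).coeff j = eval b (homogeneousComponent j (translate a P)) := by
  have h := taylor_restrictLine a b 0 P
  rw [Polynomial.taylor_zero, zero_smul, add_zero] at h
  rw [h, coeff_restrictLine_zero]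

lemma eval_homogeneousComponent [Fintype σ] [DecidableEq σ] (b : σ → R) (P : MvPolynomial σ R)
    (j : ℕ) :
    eval b (homogeneousComponent j P) =
      ∑ i ∈ Finset.finsuppAntidiag Finset.univ j, coeff i P * ∏ k, b k ^ i k := by
  have h : homogeneousComponent j P =
      ∑ i ∈ Finset.finsuppAntidiag Finset.univ j, monomial i (coeff i P) := by
    ext i
    simp [coeff_homogeneousComponent, coeff_sum, Finsupp.degree_eq_sum]
  simp [h, eval_monomial, Finsupp.prod_fintype]

lemma coeff_restrictLine_hasse {m : ℕ} (a b : Fin m → R) (l : Fin m →₀ ℕ) (j : ℕ)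
    (P : MvPolynomial (Fin m) R) :
    (restrictLine a b (hasse l P)).coeff j =
      eval b (hasse l (homogeneousComponent (l.degree + j) (translate a P))) := by
  rw [coeff_restrictLine, ← hasse_translate, hasse_homogeneousComponent]

lemma restrictLine_hasse_mem_degreeLT {m d : ℕ} (a b : Fin m → R) (l : Fin m →₀ ℕ)
    {P : MvPolynomial (Fin m) R} (hP : P.totalDegree ≤ d) :
    restrictLine a b (hasse l P) ∈ Polynomial.degreeLT R (d + 1 - l.degree) := by
  rw [Polynomial.mem_degreeLT, Polynomial.degree_lt_iff_coeff_zero]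
  intro j hj
  have := totalDegree_translate_le a P
  rw [coeff_restrictLine_hasse, homogeneousComponent_eq_zero _ _ (by omega)]
  simp [hasse]

end Line

section Multiplicity

variable {σ R : Type*}

/-- The multiplicity with which `P` vanishes at `a`: the least weight of a Hasse derivative of `P`
that does not vanish at `a`, and `⊤` if there is none. -/
noncomputable def vanishingOrder [CommSemiring R] (a : σ → R) (P : MvPolynomial σ R) : ℕ∞ :=
  (translate a P : MvPowerSeries σ R).order

section Semiring

variable [CommSemiring R] {a : σ → R} {P : MvPolynomial σ R}

lemma le_vanishingOrder_iff {c : ℕ} :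
    c ≤ vanishingOrder a P ↔ ∀ l : σ →₀ ℕ, l.degree < c → eval a (hasse l P) = 0 := by
  simp only [← coeff_translate, ← coeff_coe]
  exact ⟨fun h l hl => MvPowerSeries.coeff_of_lt_order ((Nat.cast_lt.2 hl).trans_le h),
    MvPowerSeries.nat_le_order⟩

lemma vanishingOrder_le_degree {l : σ →₀ ℕ} (h : eval a (hasse l P) ≠ 0) :
    vanishingOrder a P ≤ l.degree := by
  rw [← coeff_translate, ← coeff_coe] at h
  exact MvPowerSeries.order_le h

end Semiring

variable [CommRing R]

lemma translate_injective (a : σ → R) : Function.Injective (translate a) :=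
  Function.LeftInverse.injective (g := translate (-a)) fun P => by
    rw [translate_translate, neg_add_cancel, translate_zero]

lemma exists_degree_eq_vanishingOrder {P : MvPolynomial σ R} (hP : P ≠ 0) (a : σ → R) :
    ∃ l : σ →₀ ℕ, eval a (hasse l P) ≠ 0 ∧ l.degree = vanishingOrder a P := by
  have h : (translate a P : MvPowerSeries σ R) ≠ 0 := by
    simpa using (map_ne_zero_iff _ (translate_injective a)).2 hP
  obtain ⟨l, hl, hdeg⟩ :=
    MvPowerSeries.exists_coeff_ne_zero_and_order (MvPowerSeries.ne_zero_iff_order_finite.1 h)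
  exact ⟨l, by rwa [← coeff_translate, ← coeff_coe], hdeg⟩

end Multiplicity

section SchwartzZippel

open Polynomial (rootMultiplicity hasseDeriv)

lemma sum_piFinset_succ {A M : Type*} [AddCommMonoid M] {n : ℕ} (S : Finset A)
    (f : (Fin (n + 1) → A) → M) :
    ∑ α ∈ Fintype.piFinset (fun _ : Fin (n + 1) => S), f α =
      ∑ β ∈ Fintype.piFinset (fun _ : Fin n => S), ∑ x ∈ S, f (Fin.cons x β) := by
  rw [← Finset.sum_product']
  refine Finset.sum_nbij' (fun α => (Fin.tail α, α 0)) (fun p => Fin.cons p.2 p.1) ?_ ?_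
    (by simp) (by simp) (by simp)
  · intro α hα
    rw [Fintype.mem_piFinset] at hα
    exact Finset.mem_product.2 ⟨Fintype.mem_piFinset.2 fun k => hα _, hα 0⟩
  · intro p hp
    rw [Finset.mem_product, Fintype.mem_piFinset] at hp
    rw [Fintype.mem_piFinset]
    exact Fin.cases hp.2 hp.1

section Fiber

variable {R : Type*} [CommSemiring R] {n : ℕ}

lemma degree_cons (j : ℕ) (i : Fin n →₀ ℕ) : (i.cons j).degree = j + i.degree := by
  simp [Finsupp.degree_eq_sum, Fin.sum_univ_succ]

lemma multiChoose_cons (j k : ℕ) (i e : Fin n →₀ ℕ) :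
    multiChoose (i.cons j) (e.cons k) = (j + k).choose j * multiChoose i e := by
  simp [multiChoose, Fin.prod_univ_succ]

/-- The polynomial `G^{(0, i)}(T, β)` in the first variable of `G`. Its root multiplicities
bound the multiplicities of `G` on the line over `β`. -/
noncomputable def hasseFiber (β : Fin n → R) (i : Fin n →₀ ℕ) (G : MvPolynomial (Fin (n + 1)) R) :
    Polynomial R :=
  (finSuccEquiv R n (hasse (i.cons 0) G)).map (eval β)

variable (β : Fin n → R) (i : Fin n →₀ ℕ) (G : MvPolynomial (Fin (n + 1)) R)

lemma coeff_finSuccEquiv_hasse_cons (j k : ℕ) :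
    (finSuccEquiv R n (hasse (i.cons j) G)).coeff k =
      C ((j + k).choose j : R) * hasse i ((finSuccEquiv R n G).coeff (j + k)) := by
  ext e
  have cons_add_cons : i.cons j + e.cons k = (i + e).cons (j + k) := by
    ext x
    cases x using Fin.cases <;> simp
  rw [coeff_C_mul, finSuccEquiv_coeff_coeff, coeff_hasse, coeff_hasse, finSuccEquiv_coeff_coeff,
    multiChoose_cons, cons_add_cons, Nat.cast_mul, mul_assoc]

lemma coeff_hasseFiber (k : ℕ) :
    (hasseFiber β i G).coeff k = eval β (hasse i ((finSuccEquiv R n G).coeff k)) := by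
  simp [hasseFiber, coeff_finSuccEquiv_hasse_cons]

lemma natDegree_hasseFiber_le :
    (hasseFiber β i G).natDegree ≤ (finSuccEquiv R n G).natDegree := by
  refine Polynomial.natDegree_le_iff_coeff_eq_zero.2 fun k hk => ?_
  rw [coeff_hasseFiber, Polynomial.coeff_eq_zero_of_natDegree_lt hk]
  simp [hasse]

lemma eval_hasseDeriv_hasseFiber (j : ℕ) (x : R) :
    (hasseDeriv j (hasseFiber β i G)).eval x =
      eval (Fin.cons x β : Fin (n + 1) → R) (hasse (i.cons j) G) := by
  rw [eval_eq_eval_mv_eval']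
  congr 1
  ext k
  rw [Polynomial.hasseDeriv_coeff, coeff_hasseFiber, Polynomial.coeff_map,
    coeff_finSuccEquiv_hasse_cons, map_mul, eval_C, add_comm]

end Fiber

section Roots

variable {R : Type*} [CommRing R]

lemma le_rootMultiplicity_iff_hasseDeriv {H : Polynomial R} (hH : H ≠ 0) {x : R} {k : ℕ} :
    k ≤ rootMultiplicity x H ↔ ∀ j < k, (hasseDeriv j H).eval x = 0 := by
  simp only [Polynomial.le_rootMultiplicity_iff hH, Polynomial.X_sub_C_pow_dvd_iff,
    ← Polynomial.taylor_apply, Polynomial.X_pow_dvd_iff, Polynomial.taylor_coeff]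

lemma vanishingOrder_cons_le {n : ℕ} {G : MvPolynomial (Fin (n + 1)) R} {β : Fin n → R}
    {i : Fin n →₀ ℕ} (hH : hasseFiber β i G ≠ 0) (x : R) :
    vanishingOrder (Fin.cons x β : Fin (n + 1) → R) G ≤
      (rootMultiplicity x (hasseFiber β i G) + i.degree : ℕ) := by
  obtain ⟨j, hj, hne⟩ : ∃ j ≤ rootMultiplicity x (hasseFiber β i G),
      (hasseDeriv j (hasseFiber β i G)).eval x ≠ 0 := by
    by_contra! h
    exact absurd ((le_rootMultiplicity_iff_hasseDeriv hH).2 fun j hj => h j (Nat.lt_succ_iff.1 hj))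
      (Nat.not_succ_le_self _)
  rw [eval_hasseDeriv_hasseFiber] at hne
  refine (vanishingOrder_le_degree hne).trans ?_
  rw [degree_cons]
  exact_mod_cast Nat.add_le_add_right hj _

variable [IsDomain R]

lemma sum_rootMultiplicity_le_natDegree (S : Finset R) (H : Polynomial R) :
    ∑ x ∈ S, rootMultiplicity x H ≤ H.natDegree := by
  classical
  simp only [← Polynomial.count_roots]
  calc ∑ x ∈ S, H.roots.count x
      ≤ ∑ x ∈ S ∪ H.roots.toFinset, H.roots.count x :=
        Finset.sum_le_sum_of_subset Finset.subset_union_left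
    _ = H.roots.card := Multiset.sum_count_eq_card (by simp +contextual)
    _ ≤ H.natDegree := H.card_roots'

end Roots

variable {R : Type*} [CommRing R] [IsDomain R] (S : Finset R)

lemma sum_vanishingOrder_cons_le {n : ℕ} {G : MvPolynomial (Fin (n + 1)) R} (hG : G ≠ 0)
    (β : Fin n → R) :
    ∑ x ∈ S, vanishingOrder (Fin.cons x β : Fin (n + 1) → R) G ≤
      (finSuccEquiv R n G).natDegree +
        S.card * vanishingOrder β (finSuccEquiv R n G).leadingCoeff := by
  have hlead : (finSuccEquiv R n G).leadingCoeff ≠ 0 := by simpa using hG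
  obtain ⟨i, hi, hdeg⟩ := exists_degree_eq_vanishingOrder hlead β
  have hH : hasseFiber β i G ≠ 0 := fun h => hi <| by
    rw [Polynomial.leadingCoeff, ← coeff_hasseFiber, h, Polynomial.coeff_zero]
  calc ∑ x ∈ S, vanishingOrder (Fin.cons x β : Fin (n + 1) → R) G
      ≤ ∑ x ∈ S, ((rootMultiplicity x (hasseFiber β i G) + i.degree : ℕ) : ℕ∞) :=
        Finset.sum_le_sum fun x _ => vanishingOrder_cons_le hH x
    _ = (∑ x ∈ S, rootMultiplicity x (hasseFiber β i G) : ℕ) + S.card * i.degree := by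
        simp [Finset.sum_add_distrib]
    _ ≤ _ := by
        rw [hdeg]
        gcongr
        exact (sum_rootMultiplicity_le_natDegree S _).trans (natDegree_hasseFiber_le β i G)

theorem schwartz_zippel_vanishingOrder {n : ℕ} {G : MvPolynomial (Fin n) R} (hG : G ≠ 0) :
    S.card * ∑ α ∈ Fintype.piFinset (fun _ : Fin n => S), vanishingOrder α G ≤
      G.totalDegree * S.card ^ n := by
  induction n with
  | zero =>
    have h : ∀ α, vanishingOrder α G = 0 := fun α => by
      obtain ⟨l, -, hl⟩ := exists_degree_eq_vanishingOrder hG α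
      rw [← hl, Subsingleton.elim l 0, map_zero, Nat.cast_zero]
    simp [h]
  | succ n ih =>
    set K := finSuccEquiv R n G with hK
    have hlead : K.leadingCoeff ≠ 0 := by simpa [hK] using hG
    have hdeg : K.leadingCoeff.totalDegree + K.natDegree ≤ G.totalDegree :=
      totalDegree_coeff_finSuccEquiv_add_le G _ hlead
    rw [sum_piFinset_succ]
    calc (S.card : ℕ∞) * ∑ β ∈ Fintype.piFinset (fun _ : Fin n => S),
          ∑ x ∈ S, vanishingOrder (Fin.cons x β : Fin (n + 1) → R) G
        ≤ S.card * ∑ β ∈ Fintype.piFinset (fun _ : Fin n => S),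
            (K.natDegree + S.card * vanishingOrder β K.leadingCoeff) := by
          gcongr
          exact sum_vanishingOrder_cons_le S hG _
      _ = K.natDegree * S.card ^ (n + 1) + S.card * (S.card *
            ∑ β ∈ Fintype.piFinset (fun _ : Fin n => S), vanishingOrder β K.leadingCoeff) := by
          rw [Finset.sum_add_distrib, Finset.sum_const, ← Finset.mul_sum,
            Fintype.card_piFinset_const, nsmul_eq_mul]
          push_cast
          ring
      _ ≤ K.natDegree * S.card ^ (n + 1) +
            S.card * (K.leadingCoeff.totalDegree * S.card ^ n) := by
          gcongr _ + _ * ?_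
          exact ih hlead
      _ = (K.leadingCoeff.totalDegree + K.natDegree : ℕ) * S.card ^ (n + 1) := by
          push_cast
          ring
      _ ≤ G.totalDegree * S.card ^ (n + 1) := by gcongr

end SchwartzZippel

section AffineGrid

variable {σ R : Type*} [Fintype σ]

/-- The polynomial `P(M X)`. -/
noncomputable def linearSubst [CommSemiring R] (M : Matrix σ σ R) :
    MvPolynomial σ R →ₐ[R] MvPolynomial σ R :=
  bind₁ M.toMvPolynomial

section Semiring

variable [CommSemiring R] (M : Matrix σ σ R)

lemma translate_linearSubst (α : σ → R) (P : MvPolynomial σ R) :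
    translate α (linearSubst M P) = linearSubst M (translate (M.mulVec α) P) := by
  have h : (translate α).comp (linearSubst M) = (linearSubst M).comp (translate (M.mulVec α)) := by
    ext1 k
    simp [translate, linearSubst, Matrix.toMvPolynomial, mul_add, Finset.sum_add_distrib,
      Matrix.mulVec, dotProduct, ← C_mul_X_eq_monomial]
  exact DFunLike.congr_fun h P

lemma order_le_order_linearSubst (P : MvPolynomial σ R) :
    (P : MvPowerSeries σ R).order ≤ (linearSubst M P : MvPowerSeries σ R).order := by
  refine MvPowerSeries.le_order fun d hd => ?_
  rw [coeff_coe, P.as_sum, map_sum, coeff_sum]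
  refine Finset.sum_eq_zero fun e he => ?_
  have hde : d.degree < e.degree := by
    rw [mem_support_iff, ← coeff_coe] at he
    exact_mod_cast hd.trans_le (MvPowerSeries.order_le he)
  have hhom : (linearSubst M (monomial e (coeff e P))).IsHomogeneous (1 * e.degree) :=
    (isHomogeneous_monomial _ rfl).aeval _ M.toMvPolynomial_isHomogeneous
  exact hhom.coeff_eq_zero (by omega)

lemma vanishingOrder_add_mulVec_le (z α : σ → R) (P : MvPolynomial σ R) :
    vanishingOrder (z + M.mulVec α) P ≤ vanishingOrder α (linearSubst M (translate z P)) := by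
  simp only [vanishingOrder, translate_linearSubst, translate_translate, add_comm z]
  exact order_le_order_linearSubst M _

lemma totalDegree_linearSubst_translate_le (z : σ → R) (P : MvPolynomial σ R) :
    (linearSubst M (translate z P)).totalDegree ≤ P.totalDegree :=
  (totalDegree_aeval_le M.toMvPolynomial_totalDegree_le _).trans (totalDegree_translate_le z P)

lemma linearSubst_injective [DecidableEq σ] {N : Matrix σ σ R} (h : M * N = 1) :
    Function.Injective (linearSubst M) :=
  Function.LeftInverse.injective (g := linearSubst N) fun P => by
    simp only [linearSubst, bind₁_bind₁, ← Matrix.toMvPolynomial_mul, h,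
      Matrix.toMvPolynomial_one]
    exact aeval_X_left_apply P

end Semiring

variable {m : ℕ} {F : Type*} [Field F] (S : Finset F) (z : Fin m → F) {y : Fin m → Fin m → F}

lemma sum_smul_eq_mulVec (y : Fin m → Fin m → F) (α : Fin m → F) :
    ∑ j, α j • y j = (Matrix.of y).transpose.mulVec α := by
  ext k
  simp [Matrix.mulVec, dotProduct, mul_comm]

lemma injective_add_sum_smul (hy : LinearIndependent F y) :
    Function.Injective (fun α : Fin m → F => z + ∑ j, α j • y j) := fun _ _ h =>
  hy.fintypeLinearCombination_injective (add_left_cancel h)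

lemma card_directions_le (y : Fin m → Fin m → F) : (directions S z y).card ≤ S.card ^ m := by
  classical
  rw [directions]
  exact Finset.card_image_le.trans (Fintype.card_piFinset_const S m).le

lemma card_directions (hy : LinearIndependent F y) : (directions S z y).card = S.card ^ m := by
  classical
  rw [directions, Finset.card_image_of_injective _ (injective_add_sum_smul z hy),
    Fintype.card_piFinset_const]

lemma sum_vanishingOrder_directions_le (hy : LinearIndependent F y) {P : MvPolynomial (Fin m) F}
    (hP : P ≠ 0) :
    S.card * ∑ b ∈ directions S z y, vanishingOrder b P ≤ P.totalDegree * S.card ^ m := by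
  obtain ⟨N, hN⟩ := (Matrix.linearIndependent_rows_iff_isUnit (A := Matrix.of y)).1 hy
    |>.exists_left_inv
  set M := (Matrix.of y).transpose
  have hMN : M * N.transpose = 1 := by rw [← Matrix.transpose_mul, hN, Matrix.transpose_one]
  have hG : linearSubst M (translate z P) ≠ 0 :=
    (map_ne_zero_iff _ (linearSubst_injective M hMN)).2
      ((map_ne_zero_iff _ (translate_injective z)).2 hP)
  classical
  rw [directions, Finset.sum_image (injective_add_sum_smul z hy).injOn]
  calc (S.card : ℕ∞) * ∑ α ∈ Fintype.piFinset (fun _ : Fin m => S),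
        vanishingOrder (z + ∑ j, α j • y j) P
      ≤ S.card * ∑ α ∈ Fintype.piFinset (fun _ : Fin m => S),
          vanishingOrder α (linearSubst M (translate z P)) := by
        gcongr with α
        rw [sum_smul_eq_mulVec]
        exact vanishingOrder_add_mulVec_le M z α P
    _ ≤ (linearSubst M (translate z P)).totalDegree * S.card ^ m :=
        schwartz_zippel_vanishingOrder S hG
    _ ≤ P.totalDegree * S.card ^ m := by
        gcongr
        exact totalDegree_linearSubst_translate_le M z P

open Classical in
lemma eq_zero_of_card_directions_le (hy : LinearIndependent F y) {P : MvPolynomial (Fin m) F}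
    {c : ℕ} (hdeg : 3 * P.totalDegree < S.card * c)
    (hcard : (directions S z y).card ≤
      3 * ((directions S z y).filter (fun b => c ≤ vanishingOrder b P)).card) : P = 0 := by
  by_contra hP
  set B := (directions S z y).filter (fun b => c ≤ vanishingOrder b P)
  have hsum : (B.card * c : ℕ) ≤ ∑ b ∈ directions S z y, vanishingOrder b P :=
    calc ((B.card * c : ℕ) : ℕ∞) = B.card • (c : ℕ∞) := by simp
      _ ≤ ∑ b ∈ B, vanishingOrder b P :=
          Finset.card_nsmul_le_sum _ _ _ fun b hb => (Finset.mem_filter.1 hb).2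
      _ ≤ _ := Finset.sum_le_sum_of_subset (Finset.filter_subset _ _)
  have hle : S.card * (B.card * c) ≤ P.totalDegree * S.card ^ m := by
    exact_mod_cast (mul_le_mul_right hsum _).trans (sum_vanishingOrder_directions_le S z hy hP)
  have hpos : 0 < S.card ^ m := pow_pos (Nat.pos_of_ne_zero fun h => by simp [h] at hdeg) m
  rw [card_directions S z hy] at hcard
  nlinarith [Nat.mul_le_mul_right (S.card * c) hcard, Nat.mul_lt_mul_of_pos_right hdeg hpos]

end AffineGrid

section RelDist

variable {ι A B : Type*} [Fintype ι]

lemma relDist_comm (x y : ι → A) : relDist x y = relDist y x := by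
  classical
  rw [relDist, relDist, hammingDist_comm]

lemma relDist_triangle (x y z : ι → A) : relDist x z ≤ relDist x y + relDist y z := by
  classical
  rw [relDist, relDist, relDist, ← add_div]
  gcongr
  exact_mod_cast hammingDist_triangle x y z

lemma relDist_le_of_imp {x y : ι → A} {x' y' : ι → B} (h : ∀ i, x i = y i → x' i = y' i) :
    relDist x' y' ≤ relDist x y := by
  classical
  rw [relDist, relDist]
  gcongr
  exact Finset.card_le_card fun i => by simpa using mt (h i)

lemma one_sub_relDist_mul_card [Nonempty ι] [DecidableEq A] (x y : ι → A) :
    (1 - relDist x y) * Fintype.card ι = (Finset.univ.filter (fun i => x i = y i)).card := by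
  have hd : relDist x y = (hammingDist x y : ℝ) / Fintype.card ι := by
    unfold relDist
    congr!
  have hcard : (Finset.univ.filter (fun i => x i = y i)).card + hammingDist x y =
      Fintype.card ι := by
    rw [hammingDist, Finset.card_filter_add_card_filter_not, Finset.card_univ]
  rw [hd, sub_mul, one_mul, div_mul_cancel₀ _ (by simp), ← hcard]
  push_cast
  ring

end RelDist

section LineDecoding

variable {F : Type*} [Field F] [Fintype F] {m s d : ℕ} {δ₀ : ℝ}

lemma mul_one_sub_relDist_uniEnc_le_natDegree (n : ℕ) {Q Q' : Polynomial F} (hne : Q ≠ Q') :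
    n * ((1 - relDist (uniEnc n Q) (uniEnc n Q')) * Fintype.card F) ≤ (Q - Q').natDegree := by
  classical
  have hroot : ∀ t ∈ Finset.univ.filter (fun t => uniEnc n Q t = uniEnc n Q' t),
      n ≤ (Q - Q').rootMultiplicity t := fun t ht => by
    refine (le_rootMultiplicity_iff_hasseDeriv (sub_ne_zero.2 hne)).2 fun j hj => ?_
    rw [map_sub, Polynomial.eval_sub, sub_eq_zero]
    exact congrFun (Finset.mem_filter.1 ht).2 ⟨j, hj⟩
  rw [one_sub_relDist_mul_card, mul_comm]
  exact_mod_cast (Finset.card_nsmul_le_sum _ _ _ hroot).trans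
    (sum_rootMultiplicity_le_natDegree _ _)

lemma eq_of_relDist_uniEnc_lt {n k : ℕ} {e : ℝ} (hk : (k : ℝ) < n * ((1 - e) * Fintype.card F) + 1)
    {Q Q' : Polynomial F} (hQ : Q ∈ Polynomial.degreeLT F k) (hQ' : Q' ∈ Polynomial.degreeLT F k)
    (h : relDist (uniEnc n Q) (uniEnc n Q') < e) : Q = Q' := by
  by_contra hne
  have hdeg : (((Q - Q').natDegree + 1 : ℕ) : ℝ) ≤ k := by
    have hmem := Polynomial.mem_degreeLT.1 (Submodule.sub_mem _ hQ hQ')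
    exact_mod_cast (Polynomial.natDegree_lt_iff_degree_lt (sub_ne_zero.2 hne)).2 hmem
  have hroots : n * ((1 - e) * Fintype.card F) ≤ (Q - Q').natDegree :=
    le_trans (by gcongr) (mul_one_sub_relDist_uniEnc_le_natDegree n hne)
  push_cast at hdeg
  linarith

/-- A direction `b` is good if the word `r` agrees with the encoding of `P` on more than a fraction
`1 - 4 δ₀` of the line through `a` in direction `b`, so that decoding on this line succeeds. -/
def IsGoodDirection (δ₀ : ℝ) (P : MvPolynomial (Fin m) F) (r : (Fin m → F) → Alphabet F m s)
    (a b : Fin m → F) : Prop :=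
  relDist (fun t : F => enc s P (a + t • b)) (fun t => r (a + t • b)) < 4 * δ₀

omit [Fintype F] in
lemma lineWord_eq_uniEnc {P : MvPolynomial (Fin m) F} {r : (Fin m → F) → Alphabet F m s}
    {a b : Fin m → F} {t : F} (h : enc s P (a + t • b) = r (a + t • b)) (l : Fin m →₀ ℕ) :
    uniEnc (s - l.degree) (restrictLine a b (hasse l P)) t = lineWord r a b l t := by
  funext j
  rw [lineWord, uniEnc, eval_hasseDeriv_restrictLine, eval_homogeneousComponent]
  refine Finset.sum_congr rfl fun i hi => ?_
  have hdeg : (l + i).degree < s := by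
    have hi' : i.degree = j := by
      rw [Finsupp.degree_eq_sum]
      exact (Finset.mem_finsuppAntidiag.1 hi).1
    rw [map_add]
    omega
  rw [symbolCoord, dif_pos hdeg, ← h, enc, orderEval, coeff_translate, hasse_hasse, map_mul, eval_C]

lemma delta_le_one (s d q : ℕ) : delta s d q ≤ 1 :=
  sub_le_self _ (by positivity)

lemma one_sub_pos_of_lt_delta {q : ℕ} (h : δ₀ < delta s d q / 8) : 0 < 1 - 8 * δ₀ := by
  linarith [delta_le_one s d q]

lemma gam_pos {q : ℕ} (h : δ₀ < delta s d q / 8) : 0 < gam s d q δ₀ :=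
  div_pos (by linarith) (one_sub_pos_of_lt_delta h)

lemma gam_le_one {q : ℕ} (h : δ₀ < delta s d q / 8) : gam s d q δ₀ ≤ 1 :=
  (div_le_one (one_sub_pos_of_lt_delta h)).2 (by linarith [delta_le_one s d q])

lemma one_sub_gam_mul {q : ℕ} (hs : 0 < s) (hq : 0 < q) (h : δ₀ < delta s d q / 8) :
    (1 - gam s d q δ₀) * s * ((1 - 8 * δ₀) * q) = d := by
  have := (one_sub_pos_of_lt_delta h).ne'
  rw [gam, delta]
  field_simp
  ring

lemma cast_le_gam_mul {q w : ℕ} (h : δ₀ < delta s d q / 8) (hw : w < ordC s d q δ₀) :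
    (w : ℝ) ≤ gam s d q δ₀ * s :=
  (Nat.le_floor_iff (mul_nonneg (gam_pos h).le s.cast_nonneg)).1 (Nat.lt_succ_iff.1 hw)

lemma cast_succ_sub_lt_of_lt_ordC {q w : ℕ} (hs : 0 < s) (hq : 0 < q) (h : δ₀ < delta s d q / 8)
    (hw : w < ordC s d q δ₀) :
    ((d + 1 - w : ℕ) : ℝ) < ((s - w : ℕ) : ℝ) * ((1 - 8 * δ₀) * q) + 1 := by
  have hs' : (0 : ℝ) < s := by exact_mod_cast hs
  have hq' : 0 < (1 - 8 * δ₀) * q := mul_pos (one_sub_pos_of_lt_delta h) (by exact_mod_cast hq)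
  have hwγ := cast_le_gam_mul h hw
  have hws : w ≤ s := by
    have : (w : ℝ) ≤ s := hwγ.trans (mul_le_of_le_one_left hs'.le (gam_le_one h))
    exact_mod_cast this
  rw [Nat.cast_sub hws]
  rcases Nat.eq_zero_or_pos w with rfl | hw0
  · have : (d : ℝ) < s * ((1 - 8 * δ₀) * q) := by
      rw [← one_sub_gam_mul hs hq h]
      gcongr
      nlinarith [gam_pos h]
    simpa using this
  · have : (d : ℝ) ≤ (s - w) * ((1 - 8 * δ₀) * q) := by
      rw [← one_sub_gam_mul hs hq h]
      gcongr
      linarith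
    have hd : ((d + 1 - w : ℕ) : ℝ) ≤ d := by exact_mod_cast (by omega : d + 1 - w ≤ d)
    linarith

lemma findUnique_eq_some {α : Type*} {p : α → Prop} {x : α} (hx : p x) (h : ∀ y, p y → y = x) :
    findUnique p = some x := by
  have hex : ∃! x, p x := ⟨x, hx, h⟩
  rw [findUnique, dif_pos hex]
  exact congrArg some (h _ hex.choose_spec.1)

lemma decodeLine_eq_some (hs : 0 < s) (hδ : δ₀ < delta s d (Fintype.card F) / 8)
    {P : MvPolynomial (Fin m) F} (hP : P.totalDegree ≤ d) {r : (Fin m → F) → Alphabet F m s}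
    {a b : Fin m → F} (hb : IsGoodDirection δ₀ P r a b)
    {l : Fin m →₀ ℕ} (hl : l.degree < ordC s d (Fintype.card F) δ₀) :
    decodeLine d δ₀ r a b l = some (restrictLine a b (hasse l P)) := by
  set Q₀ := restrictLine a b (hasse l P)
  have hQ₀ : Q₀ ∈ Polynomial.degreeLT F (d + 1 - l.degree) :=
    restrictLine_hasse_mem_degreeLT a b l hP
  have hdist : relDist (uniEnc (s - l.degree) Q₀) (lineWord r a b l) < 4 * δ₀ :=
    (relDist_le_of_imp fun _ h => lineWord_eq_uniEnc h l).trans_lt hb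
  refine findUnique_eq_some ⟨hQ₀, hdist⟩ fun Q ⟨hQ, hQdist⟩ => ?_
  refine eq_of_relDist_uniEnc_lt (cast_succ_sub_lt_of_lt_ordC hs Fintype.card_pos hδ hl) hQ hQ₀ ?_
  have := relDist_triangle (uniEnc (s - l.degree) Q) (lineWord r a b l) (uniEnc (s - l.degree) Q₀)
  rw [relDist_comm] at hdist
  linarith

lemma lineValue_eq_some (hs : 0 < s) (hδ : δ₀ < delta s d (Fintype.card F) / 8)
    {P : MvPolynomial (Fin m) F} (hP : P.totalDegree ≤ d) {r : (Fin m → F) → Alphabet F m s}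
    {a b : Fin m → F} (hb : IsGoodDirection δ₀ P r a b)
    {l : Fin m →₀ ℕ} (hl : l.degree < ordC s d (Fintype.card F) δ₀) (j : ℕ) :
    lineValue d δ₀ r a j b l =
      some (eval b (hasse l (homogeneousComponent j (translate a P)))) := by
  rw [lineValue]
  split_ifs with h
  · obtain ⟨k, rfl⟩ := Nat.exists_eq_add_of_le h
    rw [decodeLine_eq_some hs hδ hP hb hl, Option.map_some, Nat.add_sub_cancel_left,
      coeff_restrictLine_hasse]
  · rw [hasse_eq_zero_of_totalDegree_lt, map_zero]
    exact (homogeneousComponent_isHomogeneous j _).totalDegree_le.trans_lt (not_le.1 h)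

end LineDecoding

section Combination

lemma card_le_three_mul_card_filter_and {α : Type*} (B : Finset α) (p q : α → Prop)
    [DecidablePred p] [DecidablePred q] (hp : 2 * B.card ≤ 3 * (B.filter p).card)
    (hq : 2 * B.card ≤ 3 * (B.filter q).card) :
    B.card ≤ 3 * (B.filter (fun b => p b ∧ q b)).card := by
  classical
  have h := Finset.card_union_add_card_inter (B.filter p) (B.filter q)
  have hunion := Finset.card_le_card
    (Finset.union_subset (Finset.filter_subset p B) (Finset.filter_subset q B))
  rw [← Finset.filter_and] at h
  omega

lemma five_mul_le_card_mul_ordC {A : Type*} {s d q : ℕ} {δ₀ : ℝ} {S : Finset A}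
    (hS : S.card = gridSize s d q δ₀) : 5 * s ≤ S.card * ordC s d q δ₀ := by
  have h := Nat.le_ceil (5 * (s : ℝ) / (ordC s d q δ₀ : ℝ))
  rw [div_le_iff₀ (by exact_mod_cast Nat.succ_pos _)] at h
  rw [hS, gridSize]
  exact_mod_cast h

lemma card_pos_of_card_eq_gridSize {A : Type*} {s d q : ℕ} {δ₀ : ℝ} {S : Finset A} (hs : 0 < s)
    (hS : S.card = gridSize s d q δ₀) : 0 < S.card := by
  have : 0 < S.card * ordC s d q δ₀ := (by positivity : 0 < 5 * s).trans_le
    (five_mul_le_card_mul_ordC hS)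
  exact Nat.pos_of_mul_pos_right this

variable {F : Type*} [Field F] [Fintype F] {m s d : ℕ} {δ₀ : ℝ} {S : Finset F}
  {r : (Fin m → F) → Alphabet F m s} {a z : Fin m → F} {y : Fin m → Fin m → F}

lemma isCombination_unique (hS : S.card = gridSize s d (Fintype.card F) δ₀)
    (hy : LinearIndependent F y) {j : ℕ} (hj : j < s) {R R' : MvPolynomial (Fin m) F}
    (hR : IsCombination d δ₀ r a (directions S z y) j R)
    (hR' : IsCombination d δ₀ r a (directions S z y) j R') : R = R' := by
  classical
  rw [← sub_eq_zero]
  refine eq_zero_of_card_directions_le S z hy (c := ordC s d (Fintype.card F) δ₀) ?_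
    ((card_le_three_mul_card_filter_and _ _ _ hR.2 hR'.2).trans ?_)
  · have := (hR.1.sub hR'.1).totalDegree_le
    have := five_mul_le_card_mul_ordC hS
    omega
  · gcongr 3 * ?_
    refine Finset.card_le_card (Finset.monotone_filter_right _ fun b _ hb => ?_)
    refine le_vanishingOrder_iff.2 fun l hl => ?_
    rw [← coeff_translate, map_sub, coeff_sub, sub_eq_zero, coeff_translate, coeff_translate]
    exact Option.some_injective _ ((hb.1 l hl).symm.trans (hb.2 l hl))

open Classical in
lemma isCombination_homogeneousComponent (hs : 0 < s)
    (hδ : δ₀ < delta s d (Fintype.card F) / 8) {P : MvPolynomial (Fin m) F}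
    (hP : P.totalDegree ≤ d) {B : Finset (Fin m → F)}
    (hgood : 2 * B.card ≤ 3 * (B.filter (IsGoodDirection δ₀ P r a)).card) (j : ℕ) :
    IsCombination d δ₀ r a B j (homogeneousComponent j (translate a P)) := by
  refine ⟨homogeneousComponent_isHomogeneous j _, hgood.trans ?_⟩
  gcongr 3 * ?_
  exact Finset.card_le_card (Finset.monotone_filter_right _ fun b _ hb l hl =>
    lineValue_eq_some hs hδ hP hb hl j)

open Classical in
theorem combine_eq_some (hs : 0 < s) (hδ : δ₀ < delta s d (Fintype.card F) / 8)
    (hS : S.card = gridSize s d (Fintype.card F) δ₀) {P : MvPolynomial (Fin m) F}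
    (hP : P.totalDegree ≤ d) (hy : LinearIndependent F y)
    (hgood : 2 * (directions S z y).card ≤
      3 * ((directions S z y).filter (IsGoodDirection δ₀ P r a)).card) :
    combine d δ₀ r a (directions S z y) = some (orderEval s P a) := by
  have hcomb := isCombination_homogeneousComponent hs hδ hP hgood
  have hex : ∀ j : Fin s, ∃! R : MvPolynomial (Fin m) F,
      IsCombination d δ₀ r a (directions S z y) j R := fun j =>
    ⟨_, hcomb j, fun _ hR => isCombination_unique hS hy j.2 hR (hcomb j)⟩
  rw [combine, dif_pos hex]
  congr 1
  funext i
  rw [isCombination_unique hS hy i.2 (hex ⟨i.1.degree, i.2⟩).choose_spec.1 (hcomb _),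
    coeff_homogeneousComponent, if_pos rfl, coeff_translate]
  rfl

end Combination

section UniformProb

variable {Ω Ω' : Type*} [Fintype Ω] [Fintype Ω']

lemma uniformProb_eq (p : Ω → Prop) [DecidablePred p] :
    uniformProb p = ((Finset.univ.filter p).card : ℝ) / Fintype.card Ω := by
  unfold uniformProb
  congr!

lemma uniformProb_nonneg (p : Ω → Prop) : 0 ≤ uniformProb p := by
  unfold uniformProb
  positivity

lemma uniformProb_le_one (p : Ω → Prop) : uniformProb p ≤ 1 :=
  div_le_one_of_le₀ (by exact_mod_cast Finset.card_le_univ _) (Nat.cast_nonneg _)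

lemma uniformProb_mono {p q : Ω → Prop} (h : ∀ ω, p ω → q ω) : uniformProb p ≤ uniformProb q := by
  classical
  rw [uniformProb_eq, uniformProb_eq]
  gcongr with ω
  exact h ω

lemma uniformProb_or_le (p q : Ω → Prop) :
    uniformProb (fun ω => p ω ∨ q ω) ≤ uniformProb p + uniformProb q := by
  classical
  rw [uniformProb_eq, uniformProb_eq, uniformProb_eq, ← add_div, Finset.filter_or]
  gcongr
  exact_mod_cast Finset.card_union_le _ _

lemma uniformProb_not [Nonempty Ω] (p : Ω → Prop) :
    uniformProb (fun ω => ¬ p ω) = 1 - uniformProb p := by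
  classical
  have h := Finset.card_filter_add_card_filter_not (s := (Finset.univ : Finset Ω)) p
  rw [uniformProb_eq, uniformProb_eq, eq_sub_iff_add_eq, ← add_div,
    div_eq_one_iff_eq (by simp), add_comm]
  exact_mod_cast h

lemma uniformProb_prod (p : Ω → Ω' → Prop) :
    uniformProb (fun x : Ω × Ω' => p x.1 x.2) =
      (∑ ω, uniformProb (p ω)) / Fintype.card Ω := by
  classical
  simp only [uniformProb_eq, ← Finset.sum_div, Fintype.card_prod, Finset.natCast_card_filter,
    Fintype.sum_prod_type, Nat.cast_mul, div_div, mul_comm]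

lemma uniformProb_prod_right (p : Ω → Ω' → Prop) :
    uniformProb (fun x : Ω × Ω' => p x.1 x.2) =
      (∑ ω', uniformProb (fun ω => p ω ω')) / Fintype.card Ω' := by
  classical
  simp only [uniformProb_eq, ← Finset.sum_div, Fintype.card_prod, Finset.natCast_card_filter,
    Fintype.sum_prod_type_right, Nat.cast_mul, div_div]

lemma uniformProb_and_prod (p : Ω → Prop) (q : Ω' → Prop) :
    uniformProb (fun x : Ω × Ω' => p x.1 ∧ q x.2) = uniformProb p * uniformProb q := by
  classical
  rw [uniformProb_eq, uniformProb_eq, uniformProb_eq, Fintype.card_prod,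
    ← Finset.univ_product_univ, Finset.filter_product, Finset.card_product]
  push_cast
  rw [mul_div_mul_comm]

lemma uniformProb_comp_of_bijective {f : Ω → Ω'} (hf : f.Bijective) (p : Ω' → Prop) :
    uniformProb (fun ω => p (f ω)) = uniformProb p := by
  classical
  rw [uniformProb_eq, uniformProb_eq, Fintype.card_of_bijective hf,
    Finset.card_bijective (t := Finset.univ.filter p) f hf (by simp)]

lemma uniformProb_comp_of_surjective {G H : Type*} [AddGroup G] [AddGroup H] [Fintype G]
    [Fintype H] (f : G →+ H) (hf : Function.Surjective f) (p : H → Prop) :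
    uniformProb (fun g => p (f g)) = uniformProb p := by
  classical
  obtain ⟨k, hk⟩ : ∃ k, ∀ h, (Finset.univ.filter fun g => f g = h).card = k :=
    ⟨_, fun h => AddMonoidHom.card_fiber_eq_of_mem_range f (hf h) (hf 0)⟩
  have hcount (q : H → Prop) [DecidablePred q] : (Finset.univ.filter fun g => q (f g)).card =
      (Finset.univ.filter q).card * k := by
    rw [Finset.card_eq_sum_card_fiberwise (f := f) (t := Finset.univ.filter q)
      (fun g hg => by simpa using hg), Finset.sum_const_nat]
    intro h hh
    rw [← hk h, Finset.filter_filter]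
    congr 1
    exact Finset.filter_congr (by grind)
  have hG : Fintype.card G = Fintype.card H * k := by simpa using hcount fun _ => True
  have hk0 : (k : ℝ) ≠ 0 := by
    have := Fintype.card_ne_zero (α := G)
    exact_mod_cast right_ne_zero_of_mul (hG ▸ this)
  rw [uniformProb_eq, uniformProb_eq, hcount p, hG]
  push_cast
  rw [mul_div_mul_right _ _ hk0]

lemma uniformProb_le_of_sum_le {f : Ω → ℝ} (hf : ∀ ω, 0 ≤ f ω) {e : ℝ} (he : 0 < e) :
    uniformProb (fun ω => e ≤ f ω) ≤ (∑ ω, f ω) / Fintype.card Ω / e := by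
  classical
  rw [uniformProb_eq, div_right_comm]
  gcongr
  rw [le_div_iff₀ he, ← nsmul_eq_mul]
  calc _ ≤ ∑ ω with e ≤ f ω, f ω :=
        Finset.card_nsmul_le_sum _ _ _ fun ω hω => (Finset.mem_filter.1 hω).2
    _ ≤ ∑ ω, f ω :=
        Finset.sum_le_sum_of_subset_of_nonneg (Finset.filter_subset _ _) fun ω _ _ => hf ω

open MeasureTheory ProbabilityTheory in
lemma uniformProb_eq_uniformOn_real [MeasurableSpace Ω] [MeasurableSingletonClass Ω]
    (p : Ω → Prop) : uniformProb p = (uniformOn Set.univ).real {ω | p ω} := by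
  classical
  rw [uniformProb_eq, measureReal_def, uniformOn_univ,
    Measure.count_apply_finite _ (Set.toFinite _)]
  simp

end UniformProb

section Cantelli

open MeasureTheory ProbabilityTheory

variable {Ω : Type*} [MeasurableSpace Ω] {μ : Measure Ω} [IsProbabilityMeasure μ]

theorem measureReal_mean_add_le_le_variance_div {X : Ω → ℝ} (hX : MemLp X 2 μ) {t : ℝ}
    (ht : 0 < t) : μ.real {ω | μ[X] + t ≤ X ω} ≤ Var[X; μ] / (Var[X; μ] + t ^ 2) := by
  have hV := variance_nonneg X μ
  -- `u` minimizes the bound that Markov's inequality for `(X - μ[X] + u) ^ 2` gives.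
  set u := Var[X; μ] / t with hu
  set Y : Ω → ℝ := fun ω => X ω + (u - μ[X]) with hY
  have hY2 : MemLp Y 2 μ := hX.add (memLp_const _)
  have hmean : μ[Y] = u := by
    rw [hY, integral_add (hX.integrable (by simp)) (integrable_const _)]
    simp
  have hsecond : μ[Y ^ 2] = Var[X; μ] + u ^ 2 := by
    rw [← variance_add_const hX.aestronglyMeasurable (u - μ[X]), variance_eq_sub hY2, hmean]
    ring
  have hmarkov : (t + u) ^ 2 * μ.real {ω | μ[X] + t ≤ X ω} ≤ Var[X; μ] + u ^ 2 := by
    rw [← hsecond]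
    refine le_trans ?_ (mul_meas_ge_le_integral_of_nonneg (.of_forall fun ω => sq_nonneg (Y ω))
      hY2.integrable_sq ((t + u) ^ 2))
    refine mul_le_mul_of_nonneg_left (measureReal_mono fun ω (hω : μ[X] + t ≤ X ω) => ?_)
      (by positivity)
    exact pow_le_pow_left₀ (by positivity) (show t + u ≤ X ω + (u - μ[X]) by linarith) 2
  calc μ.real {ω | μ[X] + t ≤ X ω} ≤ (Var[X; μ] + u ^ 2) / (t + u) ^ 2 := by
        rwa [le_div_iff₀' (by positivity)]
    _ = Var[X; μ] / (Var[X; μ] + t ^ 2) := by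
        rw [hu]
        field_simp
        ring

lemma memLp_indicator_one {A : Set Ω} (hA : MeasurableSet A) (p : ENNReal) :
    MemLp (A.indicator (1 : Ω → ℝ)) p μ :=
  memLp_indicator_const p hA 1 (.inr (measure_ne_top _ _))

lemma covariance_indicator_one {A B : Set Ω} (hA : MeasurableSet A) (hB : MeasurableSet B) :
    cov[A.indicator 1, B.indicator 1; μ] = μ.real (A ∩ B) - μ.real A * μ.real B := by
  rw [covariance_eq_sub (memLp_indicator_one hA 2) (memLp_indicator_one hB 2),
    ← Set.inter_indicator_one, integral_indicator_one (hA.inter hB), integral_indicator_one hA,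
    integral_indicator_one hB]

variable {ι : Type*} {I : Finset ι} {A : ι → Set Ω}

lemma integral_sum_indicator_one (hA : ∀ i ∈ I, MeasurableSet (A i)) :
    μ[∑ i ∈ I, (A i).indicator (1 : Ω → ℝ)] = ∑ i ∈ I, μ.real (A i) := by
  simp only [Finset.sum_apply]
  rw [integral_finsetSum _ fun i hi => (memLp_indicator_one (hA i hi) 1).integrable le_rfl]
  exact Finset.sum_congr rfl fun i hi => integral_indicator_one (hA i hi)

lemma variance_sum_indicator_one (hA : ∀ i ∈ I, MeasurableSet (A i))
    (hpair : Set.Pairwise (I : Set ι) fun i j => IndepSet (A i) (A j) μ) :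
    Var[∑ i ∈ I, (A i).indicator 1; μ] = ∑ i ∈ I, μ.real (A i) * (1 - μ.real (A i)) := by
  rw [variance_sum' fun i hi => memLp_indicator_one (hA i hi) 2]
  refine Finset.sum_congr rfl fun i hi => ?_
  rw [Finset.sum_eq_single_of_mem i hi fun j hj hji => ?_]
  · rw [covariance_indicator_one (hA i hi) (hA i hi), Set.inter_self]
    ring
  · have h := (indepSet_iff_measure_inter_eq_mul (hA i hi) (hA j hj) μ).1 (hpair hi hj hji.symm)
    rw [covariance_indicator_one (hA i hi) (hA j hj), measureReal_def, h, ENNReal.toReal_mul]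
    exact sub_self _

open Classical in
theorem measureReal_mul_card_le_card_filter_le (hA : ∀ i ∈ I, MeasurableSet (A i))
    (hpair : Set.Pairwise (I : Set ι) fun i j => IndepSet (A i) (A j) μ) {p θ : ℝ}
    (hp : ∀ i ∈ I, μ.real (A i) = p) (hI : I.Nonempty) (hθ : p < θ) :
    μ.real {ω | θ * I.card ≤ (I.filter (fun i => ω ∈ A i)).card} ≤
      p * (1 - p) / (p * (1 - p) + I.card * (θ - p) ^ 2) := by
  have hN : (0 : ℝ) < I.card := by exact_mod_cast hI.card_pos
  set X : Ω → ℝ := ∑ i ∈ I, (A i).indicator 1 with hX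
  have hX2 : MemLp X 2 μ :=
    memLp_finsetSum' _ fun i hi => memLp_indicator_one (hA i hi) 2
  have hmean : μ[X] = I.card * p := by
    rw [integral_sum_indicator_one hA, Finset.sum_congr rfl hp, Finset.sum_const, nsmul_eq_mul]
  have hvar : Var[X; μ] = I.card * (p * (1 - p)) := by
    rw [variance_sum_indicator_one hA hpair,
      Finset.sum_congr rfl fun i hi => by rw [hp i hi], Finset.sum_const, nsmul_eq_mul]
  have hcard (ω : Ω) : ((I.filter (fun i => ω ∈ A i)).card : ℝ) = X ω := by
    simp [hX, Finset.sum_apply, Set.indicator_apply]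
  have h := measureReal_mean_add_le_le_variance_div hX2 (mul_pos hN (sub_pos.2 hθ))
  rw [hmean, hvar, ← mul_add, add_sub_cancel, mul_pow, sq (I.card : ℝ), mul_assoc, ← mul_add,
    mul_div_mul_left _ _ hN.ne'] at h
  simpa only [hcard, mul_comm θ] using h

open Classical in
lemma uniformProb_mul_card_le_card_filter_le {Ω : Type*} [Fintype Ω] [Nonempty Ω]
    (bad : ι → Ω → Prop) {p θ : ℝ} (hp : ∀ i ∈ I, uniformProb (bad i) = p)
    (hpair : ∀ i ∈ I, ∀ j ∈ I, i ≠ j → uniformProb (fun ω => bad i ω ∧ bad j ω) = p * p)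
    (hI : I.Nonempty) (hθ : p < θ) :
    uniformProb (fun ω => θ * I.card ≤ (I.filter fun i => bad i ω).card) ≤
      p * (1 - p) / (p * (1 - p) + I.card * (θ - p) ^ 2) := by
  let _ : MeasurableSpace Ω := ⊤
  have hmeas (s : Set Ω) : MeasurableSet s := trivial
  have := isProbabilityMeasure_uniformOn (Ω := Ω) Set.finite_univ Set.univ_nonempty
  simp only [uniformProb_eq_uniformOn_real] at hp hpair ⊢
  refine measureReal_mul_card_le_card_filter_le (A := fun i => {ω | bad i ω})
    (fun _ _ => hmeas _) (fun i hi j hj hij => ?_) hp hI hθ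
  refine (indepSet_iff_measure_inter_eq_mul (hmeas _) (hmeas _) _).2 ?_
  rw [← ENNReal.toReal_eq_toReal_iff' (by finiteness) (by finiteness), ENNReal.toReal_mul]
  have h := hpair i hi j hj hij
  nth_rewrite 1 [← hp i hi] at h
  rwa [← hp j hj] at h

end Cantelli

section FailureBound

lemma div_add_le_div_add {a b c d : ℝ} (ha : 0 ≤ a) (hab : a ≤ b) (hc : 0 < c) (hcd : c ≤ d) :
    a / (a + d) ≤ b / (b + c) := by
  rw [div_le_div_iff₀ (by linarith) (by linarith)]
  nlinarith [mul_le_mul hab hcd hc.le (ha.trans hab)]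

lemma div_add_mul_le {V W N k : ℝ} (hk : 0 < k) (hW : 0 ≤ W) (hV : k * W ≤ V) (hV0 : 0 < V)
    (hN : 0 < N) :
    V / (V + N * W) ≤ k / (N + k) + (V - k * W) / (V + k * W) := by
  have hdiff : V / (V + N * W) - k / (N + k) =
      N * (V - k * W) / ((V + N * W) * (N + k)) := by
    field_simp
    ring
  rw [← sub_le_iff_le_add', hdiff, div_le_div_iff₀ (by positivity) (by positivity)]
  have hden : N * (V + k * W) ≤ (V + N * W) * (N + k) := by
    have : 0 ≤ k * V + N ^ 2 * W := by positivity
    linarith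
  linarith [mul_le_mul_of_nonneg_left hden (sub_nonneg.2 hV)]

-- At `p = 1 / 4` the ratio `p * (1 - p) / (1 / 3 - p) ^ 2` equals `27`.
lemma cantelli_bound_le {N p ε : ℝ} (hN : 0 < N) (hp₀ : 0 ≤ p) (hp : p ≤ 1 / 4 + ε) (hε₀ : 0 ≤ ε)
    (hε : ε < 1 / 16) :
    p * (1 - p) / (p * (1 - p) + N * (1 / 3 - p) ^ 2) ≤ 27 / (N + 27) + 77 / 5 * ε := by
  set V := 3 / 16 + ε / 2 - ε ^ 2 with hV
  set W := (1 / 12 - ε) ^ 2 with hW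
  have hV₀ : 0 < V := by nlinarith
  have hW₀ : 0 < W := pow_pos (by linarith) 2
  have hdiff : V - 27 * W = (5 - 28 * ε) * ε := by ring
  have hnum : 5 - 28 * ε ≤ 77 / 5 * (V + 27 * W) := by nlinarith [sq_nonneg (ε - 21 / 500)]
  calc p * (1 - p) / (p * (1 - p) + N * (1 / 3 - p) ^ 2)
      ≤ V / (V + N * W) := by
        refine div_add_le_div_add (mul_nonneg hp₀ (by linarith)) (by nlinarith) (by positivity) ?_
        exact mul_le_mul_of_nonneg_left (pow_le_pow_left₀ (by linarith) (by linarith) 2) hN.le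
    _ ≤ 27 / (N + 27) + (V - 27 * W) / (V + 27 * W) :=
        div_add_mul_le (by norm_num) hW₀.le (by nlinarith) hV₀ hN
    _ ≤ 27 / (N + 27) + 77 / 5 * ε := by
        gcongr
        rw [div_le_iff₀ (by positivity), hdiff, mul_right_comm]
        gcongr

end FailureBound

section LinearIndependence

lemma one_sub_pow_div_le_prod {q : ℝ} (hq : 1 < q) {k n : ℕ} (hkn : k ≤ n) :
    1 - q ^ k / (q ^ n * (q - 1)) ≤ ∏ i ∈ Finset.range k, (1 - q ^ i / q ^ n) := by
  induction k with
  | zero =>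
    have hden : 0 ≤ q ^ n * (q - 1) :=
      mul_nonneg (pow_nonneg (zero_le_one.trans hq.le) n) (sub_nonneg.2 hq.le)
    simpa only [Finset.prod_range_zero, pow_zero, sub_le_self_iff] using div_nonneg zero_le_one hden
  | succ k ih =>
    have : 0 < q := zero_lt_one.trans hq
    have hq1 : 0 < q - 1 := sub_pos.2 hq
    have hfactor : 0 ≤ 1 - q ^ k / q ^ n := by
      rw [sub_nonneg, div_le_one (by positivity)]
      exact pow_le_pow_right₀ hq.le (by lia)
    rw [Finset.prod_range_succ]
    refine le_trans ?_ (mul_le_mul_of_nonneg_right (ih (by lia)) hfactor)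
    have hdiff : (1 - q ^ k / (q ^ n * (q - 1))) * (1 - q ^ k / q ^ n) =
        1 - q ^ (k + 1) / (q ^ n * (q - 1)) + (q ^ k / q ^ n) ^ 2 / (q - 1) := by
      field_simp
      ring
    rw [hdiff, le_add_iff_nonneg_right]
    positivity

open Module in
lemma uniformProb_not_linearIndependent_le {F V : Type*} [Field F] [Fintype F] [AddCommGroup V]
    [Module F V] [Fintype V] {k : ℕ} (hk : k ≤ finrank F V) :
    uniformProb (fun y : Fin k → V => ¬ LinearIndependent F y) ≤
      (Fintype.card F : ℝ) ^ k / (Fintype.card V * (Fintype.card F - 1)) := by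
  classical
  have hq : (1 : ℝ) < Fintype.card F := by exact_mod_cast Fintype.one_lt_card
  have hcount : ((Finset.univ.filter fun y : Fin k → V => LinearIndependent F y).card : ℝ) =
      ∏ i ∈ Finset.range k, ((Fintype.card V : ℝ) - Fintype.card F ^ i) := by
    rw [← Fintype.card_subtype, ← Nat.card_eq_fintype_card, card_linearIndependent hk,
      ← Module.card_eq_pow_finrank, ← Fin.prod_univ_eq_prod_range, Nat.cast_prod]
    refine Finset.prod_congr rfl fun i _ => ?_
    rw [Nat.cast_sub, Nat.cast_pow]
    rw [Module.card_eq_pow_finrank (K := F) (V := V)]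
    exact pow_le_pow_right₀ (Fintype.one_lt_card (α := F)).le (i.2.le.trans hk)
  have hprob : uniformProb (fun y : Fin k → V => LinearIndependent F y) =
      ∏ i ∈ Finset.range k, (1 - (Fintype.card F : ℝ) ^ i / Fintype.card V) := by
    have hV : (Fintype.card V : ℝ) ≠ 0 := by exact_mod_cast Fintype.card_ne_zero
    simp_rw [uniformProb_eq, hcount, one_sub_div hV, Finset.prod_div_distrib]
    simp
  rw [uniformProb_not, hprob, sub_le_comm, Module.card_eq_pow_finrank (K := F) (V := V)]
  push_cast
  exact one_sub_pow_div_le_prod hq hk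

end LinearIndependence

section RandomDirections

variable {F V ι : Type*} [Field F] [AddCommGroup V] [Module F V] [Fintype ι]

/-- The direction `z + ∑ j, α j • y j` with parameters `α`, as a function of the random choices
`(z, y)`. -/
def direction (V : Type*) [AddCommGroup V] [Module F V] (α : ι → F) : V × (ι → V) →ₗ[F] V :=
  LinearMap.fst F V (ι → V) + ∑ j, α j • (LinearMap.proj j ∘ₗ LinearMap.snd F V (ι → V))

lemma direction_apply (α : ι → F) (ω : V × (ι → V)) :
    direction V α ω = ω.1 + ∑ j, α j • ω.2 j := by
  simp [direction]

lemma direction_surjective (α : ι → F) : Function.Surjective (direction V α) :=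
  fun u => ⟨(u, 0), by simp [direction_apply]⟩

lemma direction_prod_surjective {α β : ι → F} (h : α ≠ β) :
    Function.Surjective ((direction V α).prod (direction V β)) := by
  classical
  rintro ⟨u, v⟩
  obtain ⟨k, hk⟩ := Function.ne_iff.1 h
  set w := (α k - β k)⁻¹ • (u - v) with hw
  have hsum (γ : ι → F) : ∑ j, γ j • (Pi.single k w : ι → V) j = γ k • w := by
    rw [Finset.sum_eq_single_of_mem k (Finset.mem_univ k) fun j _ hj => by simp [hj],
      Pi.single_eq_same]
  have hdiff : α k • w - β k • w = u - v := by
    rw [← sub_smul, hw, smul_inv_smul₀ (sub_ne_zero.2 hk)]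
  refine ⟨(u - α k • w, Pi.single k w), Prod.ext ?_ ?_⟩
  · simp [direction_apply, hsum]
  · change direction V β _ = v
    rw [direction_apply, hsum, sub_add, hdiff, sub_sub_cancel]

variable [DecidableEq ι] [Fintype V]

lemma uniformProb_direction (α : ι → F) (p : V → Prop) :
    uniformProb (fun ω => p (direction V α ω)) = uniformProb p :=
  uniformProb_comp_of_surjective (direction V α).toAddMonoidHom (direction_surjective α) p

lemma uniformProb_direction_and {α β : ι → F} (h : α ≠ β) (p q : V → Prop) :
    uniformProb (fun ω => p (direction V α ω) ∧ q (direction V β ω)) =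
      uniformProb p * uniformProb q :=
  (uniformProb_comp_of_surjective ((direction V α).prod (direction V β)).toAddMonoidHom
    (direction_prod_surjective h) fun x => p x.1 ∧ q x.2).trans (uniformProb_and_prod p q)

open Classical in
lemma uniformProb_mul_card_le_card_filter_direction_le (I : Finset (ι → F)) (hI : I.Nonempty)
    (p : V → Prop) {θ : ℝ} (hθ : uniformProb p < θ) :
    uniformProb (fun ω => θ * I.card ≤ (I.filter fun α => p (direction V α ω)).card) ≤
      uniformProb p * (1 - uniformProb p) /
        (uniformProb p * (1 - uniformProb p) + I.card * (θ - uniformProb p) ^ 2) :=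
  uniformProb_mul_card_le_card_filter_le (fun α ω => p (direction V α ω))
    (fun α _ => uniformProb_direction α p) (fun _ _ _ _ h => uniformProb_direction_and h p p) hI hθ

end RandomDirections

section RandomLines

variable {F V A : Type*} [Field F] [Fintype F] [AddCommGroup V] [Module F V] [Fintype V]

lemma relDist_eq_uniformProb {ι : Type*} [Fintype ι] (x y : ι → A) :
    relDist x y = uniformProb fun i => x i ≠ y i := by
  classical
  rw [uniformProb_eq, relDist]
  unfold hammingDist
  congr!

lemma relDist_nonneg {ι : Type*} [Fintype ι] (x y : ι → A) : 0 ≤ relDist x y :=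
  relDist_eq_uniformProb x y ▸ uniformProb_nonneg _

lemma sum_relDist_line_le (x y : V → A) (a : V) :
    (∑ b, relDist (fun t : F => x (a + t • b)) (fun t => y (a + t • b))) / Fintype.card V ≤
      1 / Fintype.card F + relDist x y := by
  classical
  have hpoint (t : F) (ht : t ≠ 0) :
      uniformProb (fun b => x (a + t • b) ≠ y (a + t • b)) = relDist x y := by
    rw [relDist_eq_uniformProb]
    exact uniformProb_comp_of_bijective
      ((Equiv.addLeft a).bijective.comp (LinearEquiv.smulOfNeZero F V t ht).bijective)
      fun v => x v ≠ y v
  simp only [relDist_eq_uniformProb (ι := F)]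
  rw [← uniformProb_prod fun b t => x (a + t • b) ≠ y (a + t • b),
    uniformProb_prod_right fun b t => x (a + t • b) ≠ y (a + t • b),
    div_le_iff₀ (by positivity), ← Finset.add_sum_erase _ _ (Finset.mem_univ 0),
    Finset.sum_congr rfl fun t ht => hpoint t (Finset.ne_of_mem_erase ht), Finset.sum_const,
    nsmul_eq_mul, add_mul, one_div_mul_cancel (by simp), mul_comm]
  gcongr
  · exact uniformProb_le_one _
  · exact relDist_nonneg x y
  · exact Finset.card_le_univ _

lemma uniformProb_not_isGoodDirection_le {m s : ℕ} {δ₀ : ℝ} (hδ₀ : 0 < δ₀)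
    {P : MvPolynomial (Fin m) F} {r : (Fin m → F) → Alphabet F m s}
    (hr : relDist (enc s P) r ≤ δ₀) (a : Fin m → F) :
    uniformProb (fun b => ¬ IsGoodDirection δ₀ P r a b) ≤
      1 / 4 + 1 / (4 * δ₀ * Fintype.card F) := by
  simp only [IsGoodDirection, not_lt]
  refine (uniformProb_le_of_sum_le (fun _ => relDist_nonneg _ _)
    (by positivity : 0 < 4 * δ₀)).trans ?_
  calc _ ≤ (1 / Fintype.card F + δ₀) / (4 * δ₀) := by
        gcongr
        exact (sum_relDist_line_le _ _ a).trans (by gcongr)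
    _ = 1 / 4 + 1 / (4 * δ₀ * Fintype.card F) := by
        field_simp
        ring

end RandomLines

section Correctness

lemma gridSize_le {s d q : ℕ} {δ₀ : ℝ} (hδ : δ₀ < delta s d q / 8) :
    gridSize s d q δ₀ ≤ ⌈5 / gam s d q δ₀⌉₊ := by
  have hc : gam s d q δ₀ * s ≤ ordC s d q δ₀ := by
    rw [ordC]
    exact_mod_cast (Nat.lt_floor_add_one (gam s d q δ₀ * (s : ℝ))).le
  refine Nat.ceil_mono ?_
  rw [div_le_div_iff₀ (by exact_mod_cast Nat.succ_pos _) (gam_pos hδ)]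
  linarith

lemma one_div_sub_one_le {δ₀ q : ℝ} (hδ₀ : 0 < δ₀) (hδ₀' : δ₀ ≤ 1 / 8)
    (hq : 1 / (4 * δ₀ * q) ≤ 1 / 16) (hq₀ : 0 < q) : 1 / (q - 1) ≤ 3 / 5 * (1 / (4 * δ₀ * q)) := by
  rw [div_le_div_iff₀ (by positivity) (by norm_num)] at hq
  have hδq : δ₀ * q ≤ 1 / 8 * q := by gcongr
  rw [mul_one_div, div_le_div_iff₀ (by linarith) (by positivity)]
  linarith

variable {F : Type*} [Field F] [Fintype F] {m s d : ℕ} {δ₀ : ℝ}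

lemma mem_linePoints {a x : Fin m → F} {B : Finset (Fin m → F)} :
    x ∈ linePoints a B ↔ ∃ b ∈ B, ∃ t : F, x = a + t • b := by
  simp [linePoints, eq_comm]

lemma card_linePoints_le (a : Fin m → F) (B : Finset (Fin m → F)) :
    (linePoints a B).card ≤ B.card * Fintype.card F := by
  classical exact Finset.card_image_le.trans (by rw [Finset.card_product, Finset.card_univ])

lemma isGoodDirection_congr {P : MvPolynomial (Fin m) F} {r r' : (Fin m → F) → Alphabet F m s}
    {a b : Fin m → F} (h : ∀ t : F, r (a + t • b) = r' (a + t • b)) :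
    IsGoodDirection δ₀ P r a b ↔ IsGoodDirection δ₀ P r' a b := by
  simp only [IsGoodDirection, h]

variable {S : Finset F} {P : MvPolynomial (Fin m) F} {r : (Fin m → F) → Alphabet F m s}

open Classical in
lemma run_localCorrector_eq_some (hs : 0 < s) (hδ : δ₀ < delta s d (Fintype.card F) / 8)
    (hS : S.card = gridSize s d (Fintype.card F) δ₀) (hP : P.totalDegree ≤ d)
    {a : Fin m → F} {ω : (Fin m → F) × (Fin m → Fin m → F)} (hω : LinearIndependent F ω.2)
    (hbad : 3 * ((Fintype.piFinset fun _ => S).filter fun α =>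
      ¬ IsGoodDirection δ₀ P r a (direction (Fin m → F) α ω)).card ≤ S.card ^ m) :
    (localCorrector s d δ₀ S a ω.1 ω.2).run r = some (orderEval s P a) := by
  refine combine_eq_some hs hδ hS hP hω ?_
  have hfilter : (directions S ω.1 ω.2).filter (IsGoodDirection δ₀ P
      (fun x => if x ∈ linePoints a (directions S ω.1 ω.2) then r x else 0) a) =
      (directions S ω.1 ω.2).filter (IsGoodDirection δ₀ P r a) :=
    Finset.filter_congr fun b hb => isGoodDirection_congr fun t =>
      if_pos (mem_linePoints.2 ⟨b, hb, t, rfl⟩)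
  have hgood : ((directions S ω.1 ω.2).filter (IsGoodDirection δ₀ P r a)).card =
      ((Fintype.piFinset fun _ => S).filter fun α =>
        IsGoodDirection δ₀ P r a (direction (Fin m → F) α ω)).card := by
    simp only [direction_apply]
    rw [directions, Finset.filter_image,
      Finset.card_image_of_injective _ (injective_add_sum_smul ω.1 hω)]
  have hsplit := Finset.card_filter_add_card_filter_not (s := Fintype.piFinset fun _ : Fin m => S)
    fun α => IsGoodDirection δ₀ P r a (direction (Fin m → F) α ω)
  rw [Fintype.card_piFinset_const] at hsplit
  calc 2 * (directions S ω.1 ω.2).card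
      ≤ 3 * ((directions S ω.1 ω.2).filter (IsGoodDirection δ₀ P r a)).card := by
        rw [hgood, card_directions S ω.1 hω]
        lia
    _ = _ := by
        rw [← hfilter]
        rfl

lemma uniformProb_not_linearIndependent_snd_le :
    uniformProb (fun ω : (Fin m → F) × (Fin m → Fin m → F) => ¬ LinearIndependent F ω.2) ≤
      1 / ((Fintype.card F : ℝ) - 1) := by
  have hsnd := uniformProb_comp_of_surjective (AddMonoidHom.snd (Fin m → F) (Fin m → Fin m → F))
    Prod.snd_surjective fun y => ¬ LinearIndependent F y
  refine (hsnd.trans_le (uniformProb_not_linearIndependent_le (by simp))).trans_eq ?_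
  rw [Fintype.card_pi_const, Nat.cast_pow]
  field_simp

lemma uniformProb_run_localCorrector_ne_le (hs : 0 < s) (hδ : δ₀ < delta s d (Fintype.card F) / 8)
    (hS : S.card = gridSize s d (Fintype.card F) δ₀) (hP : P.totalDegree ≤ d) (a : Fin m → F)
    {p : ℝ} (hp : uniformProb (fun b => ¬ IsGoodDirection δ₀ P r a b) = p) (hp' : p < 1 / 3) :
    uniformProb (fun ω : (Fin m → F) × (Fin m → Fin m → F) =>
        (localCorrector s d δ₀ S a ω.1 ω.2).run r ≠ some (orderEval s P a)) ≤
      p * (1 - p) / (p * (1 - p) + (S.card : ℝ) ^ m * (1 / 3 - p) ^ 2) +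
        1 / ((Fintype.card F : ℝ) - 1) := by
  classical
  subst hp
  have hS0 : S.Nonempty := Finset.card_pos.1 (card_pos_of_card_eq_gridSize hs hS)
  have hcantelli := uniformProb_mul_card_le_card_filter_direction_le
    (Fintype.piFinset fun _ : Fin m => S) (Fintype.piFinset_nonempty.2 fun _ => hS0)
    (fun b => ¬ IsGoodDirection δ₀ P r a b) hp'
  rw [Fintype.card_piFinset_const, Nat.cast_pow] at hcantelli
  refine le_trans (uniformProb_mono fun ω hω => ?_) ((uniformProb_or_le _ _).trans
    (add_le_add hcantelli uniformProb_not_linearIndependent_snd_le))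
  by_contra h
  rw [not_or, not_not, not_le] at h
  refine hω (run_localCorrector_eq_some hs hδ hS hP h.2 ?_)
  have hreal := h.1
  rw [one_div, inv_mul_eq_div, lt_div_iff₀ three_pos, mul_comm] at hreal
  have hcard := hreal.le
  norm_cast at hcard
  convert hcard

theorem le_uniformProb_run_localCorrector (hs : 0 < s) (hδ : δ₀ < delta s d (Fintype.card F) / 8)
    (hS : S.card = gridSize s d (Fintype.card F) δ₀) (hP : P.totalDegree ≤ d)
    (hr : relDist (enc s P) r < δ₀) (a : Fin m → F) :
    1 - (27 / ((S.card : ℝ) ^ m + 27) + 4 / (δ₀ * (Fintype.card F : ℝ))) ≤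
      uniformProb (fun ω : (Fin m → F) × (Fin m → Fin m → F) =>
        (localCorrector s d δ₀ S a ω.1 ω.2).run r = some (orderEval s P a)) := by
  have hδ₀ : 0 < δ₀ := hr.trans_le' (relDist_nonneg _ _)
  set ε := 1 / (4 * δ₀ * Fintype.card F) with hε
  have hε₀ : 0 < ε := by positivity
  have h16 : 4 / (δ₀ * (Fintype.card F : ℝ)) = 16 * ε := by
    rw [hε]
    field_simp
    norm_num
  rw [h16]
  rcases le_or_gt (1 / 16) ε with hbig | hsmall
  · refine le_trans ?_ (uniformProb_nonneg _)
    have : 0 < 27 / ((S.card : ℝ) ^ m + 27) := by positivity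
    linarith
  have hp : _ ≤ 1 / 4 + ε := uniformProb_not_isGoodDirection_le hδ₀ hr.le a
  have hfail := uniformProb_run_localCorrector_ne_le (r := r) hs hδ hS hP a rfl (by linarith)
  have hcantelli := cantelli_bound_le (N := (S.card : ℝ) ^ m)
    (pow_pos (Nat.cast_pos.2 (card_pos_of_card_eq_gridSize hs hS)) m)
    (uniformProb_nonneg _) hp hε₀.le hsmall
  have hdep := one_div_sub_one_le hδ₀ (by linarith [one_sub_pos_of_lt_delta hδ]) hsmall.le
    (by positivity)
  simp only [ne_eq] at hfail
  rw [uniformProb_not] at hfail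
  linarith

end Correctness

end MultCode

theorem mainTheorem1 {F : Type*} [Field F] [Fintype F] (m s d : ℕ) (hs : 0 < s)
    (δ₀ : ℝ) (hδ₀ : δ₀ < MultCode.delta s d (Fintype.card F) / 8)
    (S : Finset F) (hS : S.card = MultCode.gridSize s d (Fintype.card F) δ₀)
    (P : MvPolynomial (Fin m) F) (hP : P.totalDegree ≤ d)
    (r : (Fin m → F) → MultCode.Alphabet F m s)
    (hr : MultCode.relDist (MultCode.enc s P) r < δ₀) (a : Fin m → F) :
    -- correctness with high probability over the uniform choice of `(z, y₁, …, y_m)`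
    1 - (27 / ((S.card : ℝ) ^ m + 27) + 4 / (δ₀ * (Fintype.card F : ℝ))) ≤
        MultCode.uniformProb (fun ω : (Fin m → F) × (Fin m → Fin m → F) =>
          (MultCode.localCorrector s d δ₀ S a ω.1 ω.2).run r = some (MultCode.orderEval s P a)) ∧
    -- query complexity, for every choice of `(z, y₁, …, y_m)`
    (∀ (z : Fin m → F) (y : Fin m → Fin m → F),
      (∀ x : Fin m → F, x ∈ (MultCode.localCorrector s d δ₀ S a z y).queries ↔
        ∃ b ∈ MultCode.directions S z y, ∃ t : F, x = a + t • b) ∧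
      (MultCode.directions S z y).card ≤ S.card ^ m ∧
      (MultCode.localCorrector s d δ₀ S a z y).queries.card ≤ S.card ^ m * Fintype.card F) ∧
    S.card ≤ ⌈5 / MultCode.gam s d (Fintype.card F) δ₀⌉₊ := by
  refine ⟨MultCode.le_uniformProb_run_localCorrector hs hδ₀ hS hP hr a, fun z y => ⟨fun x =>
    MultCode.mem_linePoints, MultCode.card_directions_le S z y, ?_⟩, ?_⟩
  · exact (MultCode.card_linePoints_le a _).trans
      (Nat.mul_le_mul_right _ (MultCode.card_directions_le S z y))
  · rw [hS]
    exact MultCode.gridSize_le hδ₀
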